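/- Let $\sigma\ge 1$ be an integer. For $n\ge 2$ let the puzzle graph be the ring (cycle) on the vertex set $\mathbb Z_n$, and let the people graph be the Erdős–Rényi random graph on $\mathbb Z_n$ in which each pair of vertices is joined independently with probability $p\in[0,1]$. Consider jigsaw percolation with verification threshold $\sigma$, link threshold $\tau=1$ and exemption threshold $\theta=\infty$: start from the partition of $\mathbb Z_n$ into singletons and, at each time step, form the graph whose vertices are the sets of the current partition and in which two distinct sets $W,W'$ are joined if (in one of the two orders) either some $v\in W$ and $v'\in W'$ are adjacent in both graphs, or some $v\in W$ has at least $\sigma$ people-graph neighbours and at least one puzzle-graph neighbour in $W'$; then merge all sets that lie in the same connected component of this graph. Let $\mathrm{Solve}$ be the event that the partition eventually becomes $\{\mathbb Z_n\}$. For every $n\ge2$ there is a unique critical probability $p_c=p_c(n)\in[0,1]$ with $\mathbb P_{p_c}(\mathrm{Solve})=\tfrac12$. Put $$\lambda_\sigma=\int_0^\infty -\log \mathbb P(\mathrm{Poisson}(x)\ge\sigma)\,dx .$$ Then $\lambda_\sigma<\infty$ and, as $n\to\infty$, $$p_c\log n\to\lambda_\sigma,$$ with sharp transition: for every $\varepsilon>0$,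 $\mathbb P_{(1-\varepsilon)p_c}(\mathrm{Solve})\to0$ and $\mathbb P_{(1+\varepsilon)p_c}(\mathrm{Solve})\to1$, where $(1\pm\varepsilon)p_c$ is truncated to $[0,1]$. -/

import Mathlib

open MeasureTheory ProbabilityTheory Set Filter Topology

noncomputable section

namespace Jigsaw

/-! ### The deterministic dynamics

A partition of the vertex set `V` is represented by the corresponding equivalence relation, a
`Setoid V`; its sets (the clusters) are the elements of the quotient. -/

section Dynamics

variable {V : Type*}

/-- The number of `G`-neighbours of `v` in `S`. (A vertex is never its own neighbour.) -/
def numNbrs (G : SimpleGraph V) (v : V) (S : Set V) : ℕ∞ :=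
  (G.neighborSet v ∩ S).encard

/-- The set of vertices belonging to a cluster of the partition `P`. -/
def clusterSet (P : Setoid V) (W : Quotient P) : Set V :=
  {v | (Quotient.mk P v) = W}

/-- One of the merging criteria holds for the ordered pair `(A, B)` of sets of vertices:
there are doubly connected vertices `v₁ ∈ A` and `v₂ ∈ B`; or some `v ∈ A` has at least `θ`
puzzle neighbours in `B`; or some `v ∈ A` has at least `σ` people neighbours and at least `τ`
puzzle neighbours in `B`. The value `θ = ⊤` is the exemption threshold `∞`. -/
def Links (puz ppl : SimpleGraph V) (σ τ : ℕ) (θ : ℕ∞) (A B : Set V) : Prop :=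
  (∃ v₁ ∈ A, ∃ v₂ ∈ B, ppl.Adj v₁ v₂ ∧ puz.Adj v₁ v₂) ∨
  (∃ v ∈ A, θ ≤ numNbrs puz v B) ∨
  (∃ v ∈ A, (σ : ℕ∞) ≤ numNbrs ppl v B ∧ (τ : ℕ∞) ≤ numNbrs puz v B)

/-- The graph on the clusters of `P` in which two distinct clusters are joined when the merging
criteria hold for them, in one of the two orders. -/
def mergeGraph (puz ppl : SimpleGraph V) (σ τ : ℕ) (θ : ℕ∞) (P : Setoid V) :
    SimpleGraph (Quotient P) :=
  SimpleGraph.fromRel fun W W' =>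
    Links puz ppl σ τ θ (clusterSet P W) (clusterSet P W')

/-- One step of jigsaw percolation: all clusters in the same connected component of the merge
graph are merged. -/
def step (puz ppl : SimpleGraph V) (σ τ : ℕ) (θ : ℕ∞) (P : Setoid V) : Setoid V :=
  (mergeGraph puz ppl σ τ θ P).reachableSetoid.comap (Quotient.mk P)

/-- The partition at time `t`, started from the partition into singletons. -/
def partitionAt (puz ppl : SimpleGraph V) (σ τ : ℕ) (θ : ℕ∞) (t : ℕ) : Setoid V :=
  (step puz ppl σ τ θ)^[t] ⊥

/-- The puzzle is solved: at some time all vertices are in a single cluster. -/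
def Solves (puz ppl : SimpleGraph V) (σ τ : ℕ) (θ : ℕ∞) : Prop :=
  ∃ t : ℕ, partitionAt puz ppl σ τ θ t = ⊤

/-- The probability that the puzzle `puz` is solved when the people graph is the Erdős–Rényi
graph on `V` with edge probability `p`. -/
def solveProb (puz : SimpleGraph V) (σ τ : ℕ) (θ : ℕ∞) (p : unitInterval) : ℝ :=
  (SimpleGraph.binomialRandom V p).real {ppl | Solves puz ppl σ τ θ}

end Dynamics

/-! ### Critical probability and sharp transition -/

/-- `p` is a critical probability for the function `p ↦ P p`. -/
def IsCriticalProb (P : unitInterval → ℝ) (p : unitInterval) : Prop :=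
  P p = 1 / 2

/-- Sharp transition of `P n` at `pc n` as `n → ∞`. The arguments `(1 ± ε) * pc n` are truncated
to `[0, 1]`, where `P n` is defined. -/
def SharpTransition (P : ℕ → unitInterval → ℝ) (pc : ℕ → unitInterval) : Prop :=
  ∀ ε : ℝ, 0 < ε →
    Tendsto (fun n => P n (Set.projIcc 0 1 zero_le_one ((1 - ε) * (pc n : ℝ)))) atTop (𝓝 0) ∧
    Tendsto (fun n => P n (Set.projIcc 0 1 zero_le_one ((1 + ε) * (pc n : ℝ)))) atTop (𝓝 1)

/-! ### The ring -/

/-- The probability of solving the ring puzzle on `n` vertices with `τ = 1`, `θ = ∞` and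
verification threshold `σ`, as a function of the edge probability of the people graph. -/
def ringSolveProb (σ n : ℕ) (p : unitInterval) : ℝ :=
  solveProb (SimpleGraph.cycleGraph n) σ 1 ⊤ p

/-- `g_σ(x) = - log ℙ(Poisson(x) ≥ σ)` (for `x ≥ 0`). -/
def poissonRate (σ : ℕ) (x : ℝ) : ℝ :=
  - Real.log ((poissonMeasure x.toNNReal).real (Set.Ici σ))

/-- `λ_σ = ∫₀^∞ g_σ(x) dx`. -/
def ringConst (σ : ℕ) : ℝ :=
  ∫ x in Set.Ioi (0 : ℝ), poissonRate σ x

end Jigsaw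

end

/-!
The proof compares two estimates for the probability that a short arc of the ring is internally
solved, i.e. solved using only the people edges between its vertices. Write `λ` for `ringConst σ`.

*Above the threshold.* An interval of length `k` can be extended by the next vertex if that vertex
has `σ` people neighbours in it, or, which matters for `k < σ` only, if it is a people neighbour of
the last vertex. These events are independent for different `k`. Hence an interval of any length `L`
is internally solved with probability at least
`∏ k < L, max p ℙ(Bin(k, p) ≥ σ) ≥ exp (-(λ + o(1)) / p)`, the logarithm of the product being
essentially a Riemann sum for the integral `λ` (`eventually_exp_le_prod_binomTail`). If
`p = (1 + ε) λ / log n`, this is much larger than `log n ^ 2 / n`, so that with `L` of order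
`log n ^ 2` one of `n / L` disjoint intervals
is internally solved. Since `p * L` is a large multiple of `log n`, all other vertices have `σ`
people neighbours in each of these intervals, and the solved one spreads over the ring
(`one_sub_ringSolveProb_le`).

*Below the threshold.* The puzzle is solved if and only if the whole vertex set can be assembled
by merging two linked disjoint sets at a time (`solves_iff`), and then an internally solved arc of
every order of magnitude occurs on the way. The main estimate
(`binomialRandom_real_internallySolved_le`) is that an arc of size `M / p`, with `M` large, is
internally solved with probability at most `exp (-(λ - o(1)) / p)`. The order in which its vertices
are added is irrelevant: the history of the arc is observed only each time its size has changed by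
`d = δ / p`, which leaves a number of possible histories that is polynomial in `1 / p`. Between two
observations `J ⊆ I` every vertex of `I \ J`, up to the ends, has `σ` people neighbours in `J` or a
people neighbour in `I \ J`; the second possibility is rare when `δ` is small
(`binomialRandom_real_inter_good_le`). This gives a factor `ℙ(Bin(#J, p) ≥ σ)` for each added vertex.
When two large internally solved sets merge, their probabilities multiply by independence, and the
bound is kept because the cost `-log ℙ(Bin(k, p) ≥ σ)` of a vertex is decreasing in `k`, so that the
total cost is subadditive. This cost is infinite for `k < σ`, and is therefore truncated at a large
constant `c`; sets of size below a small multiple of `1 / p` cost at least `c` per vertex because their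
vertices must all have a people neighbour inside. A union bound over the `O(n log n)` arcs of size
of order `log n` concludes.

Finally the solving probability is a polynomial in `p`, strictly increasing because solving is a
non-trivial increasing event.
-/

noncomputable section

namespace Jigsaw

open scoped NNReal

/-! ### Poisson and binomial tails -/

section Tails

/-- `ℙ(Poisson(x) ≥ σ)`. -/
def poissonTail (σ : ℕ) (x : ℝ≥0) : ℝ := (poissonMeasure x).real (Ici σ)

theorem poissonTail_nonneg (σ : ℕ) (x : ℝ≥0) : 0 ≤ poissonTail σ x := measureReal_nonneg

theorem poissonTail_le_one (σ : ℕ) (x : ℝ≥0) : poissonTail σ x ≤ 1 := measureReal_le_one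

theorem poissonTail_zero (x : ℝ≥0) : poissonTail 0 x = 1 := by
  have : Ici (0 : ℕ) = univ := by ext; simp
  simp [poissonTail, this]

theorem poissonTail_anti (x : ℝ≥0) {σ τ : ℕ} (h : σ ≤ τ) : poissonTail τ x ≤ poissonTail σ x :=
  measureReal_mono (Ici_subset_Ici.2 h)

theorem poissonMeasure_real_Ici_one (x : ℝ≥0) :
    (poissonMeasure x).real (Ici 1) = 1 - Real.exp (-x) := by
  have : Ici (1 : ℕ) = {0}ᶜ := by ext n; simp [Nat.one_le_iff_ne_zero]
  rw [this, probReal_compl_eq_one_sub .of_discrete, poissonMeasure_real_singleton]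
  simp

theorem poissonTail_at_zero (σ : ℕ) : poissonTail (σ + 1) 0 = 0 := by
  refine le_antisymm ?_ (poissonTail_nonneg _ _)
  refine (poissonTail_anti 0 (by omega : 1 ≤ σ + 1)).trans ?_
  rw [poissonTail, poissonMeasure_real_Ici_one]; simp

theorem poissonMeasure_real_Ici_two (x : ℝ≥0) :
    (poissonMeasure x).real (Ici 2) = 1 - Real.exp (-x) - x * Real.exp (-x) := by
  have : (Ici 1 : Set ℕ) = {1} ∪ Ici 2 := by ext n; simp; omega
  have h := poissonMeasure_real_Ici_one x
  rw [this, measureReal_union (by simp) .of_discrete, poissonMeasure_real_singleton] at h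
  simp at h
  linarith

theorem poissonTail_add (σ : ℕ) (x y : ℝ≥0) :
    poissonTail σ (x + y) =
      ((poissonMeasure x).prod (poissonMeasure y)).real {z | σ ≤ z.1 + z.2} := by
  rw [poissonTail, ← poissonMeasure_conv_poissonMeasure, measureReal_def, measureReal_def,
    Measure.conv, Measure.map_apply (by fun_prop) .of_discrete]
  rfl

theorem poissonTail_mono (σ : ℕ) : Monotone (poissonTail σ) := by
  intro x z h
  obtain ⟨y, rfl⟩ := exists_add_of_le h
  rw [poissonTail_add]
  have : poissonTail σ x
      = ((poissonMeasure x).prod (poissonMeasure y)).real (Ici σ ×ˢ univ) := by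
    rw [measureReal_prod_prod]; simp [poissonTail]
  rw [this]
  refine measureReal_mono ?_
  rintro ⟨a, b⟩ ⟨h, -⟩
  simp at h ⊢
  omega

/-- Splitting off whether an independent `Poisson(y)` summand is positive. -/
theorem le_poissonTail_add (σ : ℕ) (x y : ℝ≥0) :
    Real.exp (-y) * poissonTail (σ + 1) x + (1 - Real.exp (-y)) * poissonTail σ x
      ≤ poissonTail (σ + 1) (x + y) := by
  rw [poissonTail_add]
  have h1 : Real.exp (-y) * poissonTail (σ + 1) x
      = ((poissonMeasure x).prod (poissonMeasure y)).real (Ici (σ + 1) ×ˢ {0}) := by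
    rw [measureReal_prod_prod, poissonMeasure_real_singleton]; simp [poissonTail, mul_comm]
  have h2 : (1 - Real.exp (-y)) * poissonTail σ x
      = ((poissonMeasure x).prod (poissonMeasure y)).real (Ici σ ×ˢ Ici 1) := by
    rw [measureReal_prod_prod, poissonMeasure_real_Ici_one]; simp [poissonTail, mul_comm]
  rw [h1, h2, ← measureReal_union _ .of_discrete]
  · refine measureReal_mono ?_
    rintro ⟨a, b⟩ (⟨h, h'⟩ | ⟨h, h'⟩) <;> simp at h h' ⊢ <;> omega
  · rw [Set.disjoint_left]
    rintro ⟨a, b⟩ ⟨h, h'⟩ ⟨h3, h4⟩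
    simp at h h' h3 h4
    omega

/-- Splitting off whether an independent `Poisson(y)` summand is `0`, `1` or larger. -/
theorem poissonTail_add_le (σ : ℕ) (x y : ℝ≥0) :
    poissonTail (σ + 1) (x + y) ≤ Real.exp (-y) * poissonTail (σ + 1) x
      + y * Real.exp (-y) * poissonTail σ x + (1 - Real.exp (-y) - y * Real.exp (-y)) := by
  rw [poissonTail_add]
  have h1 : Real.exp (-y) * poissonTail (σ + 1) x
      = ((poissonMeasure x).prod (poissonMeasure y)).real (Ici (σ + 1) ×ˢ {0}) := by
    rw [measureReal_prod_prod, poissonMeasure_real_singleton]; simp [poissonTail, mul_comm]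
  have h2 : y * Real.exp (-y) * poissonTail σ x
      = ((poissonMeasure x).prod (poissonMeasure y)).real (Ici σ ×ˢ {1}) := by
    rw [measureReal_prod_prod, poissonMeasure_real_singleton]; simp [poissonTail, mul_comm]
  have h3 : (1 - Real.exp (-y) - y * Real.exp (-y))
      = ((poissonMeasure x).prod (poissonMeasure y)).real (univ ×ˢ Ici 2) := by
    rw [measureReal_prod_prod, poissonMeasure_real_Ici_two]; simp
  rw [h1, h2, h3]
  refine le_trans (measureReal_mono ?_) ((measureReal_union_le _ _).trans
    (add_le_add_left (measureReal_union_le _ _) _))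
  rintro ⟨a, b⟩ h
  simp at h ⊢
  omega

/-- The probability that a sum of `k` independent Bernoulli variables of parameter `p` is at least
`σ`, through the recursion that splits off one of them. -/
def binomTail (p : ℝ) : ℕ → ℕ → ℝ
  | _, 0 => 1
  | 0, _ + 1 => 0
  | k + 1, σ + 1 => p * binomTail p k σ + (1 - p) * binomTail p k (σ + 1)

@[simp] theorem binomTail_zero_right (p : ℝ) (k : ℕ) : binomTail p k 0 = 1 := by
  cases k <;> rfl

@[simp] theorem binomTail_zero_succ (p : ℝ) (σ : ℕ) : binomTail p 0 (σ + 1) = 0 := rfl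

theorem binomTail_succ_succ (p : ℝ) (k σ : ℕ) :
    binomTail p (k + 1) (σ + 1) = p * binomTail p k σ + (1 - p) * binomTail p k (σ + 1) := rfl

variable {p : ℝ}

theorem binomTail_nonneg (h0 : 0 ≤ p) (h1 : p ≤ 1) (k σ : ℕ) : 0 ≤ binomTail p k σ := by
  induction k generalizing σ with
  | zero => cases σ <;> simp
  | succ k ih =>
    cases σ with
    | zero => simp
    | succ σ =>
      rw [binomTail_succ_succ]
      have := ih σ
      have := ih (σ + 1)
      have : 0 ≤ 1 - p := by linarith
      positivity

theorem binomTail_le_one (h0 : 0 ≤ p) (h1 : p ≤ 1) (k σ : ℕ) : binomTail p k σ ≤ 1 := by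
  induction k generalizing σ with
  | zero => cases σ <;> simp
  | succ k ih =>
    cases σ with
    | zero => simp
    | succ σ =>
      rw [binomTail_succ_succ]
      have := ih σ
      have := ih (σ + 1)
      nlinarith

theorem binomTail_anti_right (h0 : 0 ≤ p) (h1 : p ≤ 1) (k σ : ℕ) :
    binomTail p k (σ + 1) ≤ binomTail p k σ := by
  induction k generalizing σ with
  | zero => cases σ <;> simp
  | succ k ih =>
    cases σ with
    | zero => simpa using binomTail_le_one h0 h1 _ _
    | succ σ =>
      rw [binomTail_succ_succ, binomTail_succ_succ]
      have := ih σ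
      have := ih (σ + 1)
      have : 0 ≤ 1 - p := by linarith
      gcongr

theorem binomTail_le_succ (h0 : 0 ≤ p) (h1 : p ≤ 1) (k σ : ℕ) :
    binomTail p k σ ≤ binomTail p (k + 1) σ := by
  cases σ with
  | zero => simp
  | succ σ =>
    rw [binomTail_succ_succ]
    nlinarith [binomTail_anti_right h0 h1 k σ]

theorem binomTail_mono_left (h0 : 0 ≤ p) (h1 : p ≤ 1) (σ : ℕ) :
    Monotone fun k => binomTail p k σ :=
  monotone_nat_of_le_succ fun k => binomTail_le_succ h0 h1 k σ

theorem binomTail_one (k : ℕ) : binomTail p k 1 = 1 - (1 - p) ^ k := by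
  induction k with
  | zero => simp
  | succ k ih => rw [binomTail_succ_succ, ih]; simp; ring

theorem pow_le_binomTail_self (h0 : 0 ≤ p) (h1 : p ≤ 1) (σ : ℕ) : p ^ σ ≤ binomTail p σ σ := by
  induction σ with
  | zero => simp
  | succ σ ih =>
    rw [binomTail_succ_succ, pow_succ]
    have := binomTail_nonneg h0 h1 σ (σ + 1)
    nlinarith

/-- `k` Bernoulli variables of parameter `1 - exp (-s)` are dominated by Poisson variables of
mean `s`. -/
theorem binomTail_le_poissonTail (s : ℝ≥0) (k σ : ℕ) :
    binomTail (1 - Real.exp (-s)) k σ ≤ poissonTail σ (k * s) := by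
  have h1 : Real.exp (-(s : ℝ)) ≤ 1 := Real.exp_le_one_iff.2 (by simp)
  induction k generalizing σ with
  | zero =>
    cases σ with
    | zero => simp [poissonTail_zero]
    | succ σ => simpa using poissonTail_nonneg _ _
  | succ k ih =>
    cases σ with
    | zero => simp [poissonTail_zero]
    | succ σ =>
      have := le_poissonTail_add σ (k * s) s
      rw [binomTail_succ_succ]
      push_cast
      rw [add_mul, one_mul]
      refine le_trans ?_ this
      have a := ih σ
      have b := ih (σ + 1)
      have := Real.exp_pos (-(s : ℝ))
      nlinarith

/-- Le Cam's estimate, in one direction: each Bernoulli variable is replaced by a Poisson one at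
the cost of `p ^ 2`. -/
theorem poissonTail_le_binomTail (q : ℝ≥0) (hq : q ≤ 1) (k σ : ℕ) :
    poissonTail σ (k * q) ≤ binomTail q k σ + k * (q : ℝ) ^ 2 := by
  have hq' : (q : ℝ) ≤ 1 := by exact_mod_cast hq
  have e2 : 1 - (q : ℝ) ≤ Real.exp (-(q : ℝ)) := by
    linarith [Real.add_one_le_exp (-(q : ℝ))]
  induction k generalizing σ with
  | zero =>
    cases σ with
    | zero => simp [poissonTail_zero]
    | succ σ => simp [poissonTail_at_zero]
  | succ k ih =>
    cases σ with
    | zero => simp [poissonTail_zero]; positivity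
    | succ σ =>
      have h := poissonTail_add_le σ (k * q) q
      have a := ih σ
      have b := ih (σ + 1)
      rw [binomTail_succ_succ]
      push_cast
      rw [add_mul, one_mul]
      refine h.trans ?_
      have t1 := poissonTail_le_one (σ + 1) (k * q)
      have t0 := poissonTail_le_one σ (k * q)
      have t1' := poissonTail_nonneg (σ + 1) (k * q)
      have t0' := poissonTail_nonneg σ (k * q)
      have q0 : (0 : ℝ) ≤ q := q.2
      have e3 : Real.exp (-(q : ℝ)) ≤ 1 := Real.exp_le_one_iff.2 (by simp)
      set E := Real.exp (-(q : ℝ))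
      set A := poissonTail (σ + 1) (k * q)
      set B := poissonTail σ (k * q)
      have c1 : (E - (1 - q)) * A ≤ (E - (1 - q)) * 1 :=
        mul_le_mul_of_nonneg_left t1 (by linarith)
      have c2 : q * E * B ≤ q * B := by nlinarith [mul_nonneg q0 t0']
      have c3 : q * (1 - q) ≤ q * E := mul_le_mul_of_nonneg_left e2 q0
      have c4 : (1 - q) * A ≤ (1 - q) * (binomTail q k (σ + 1) + k * q ^ 2) :=
        mul_le_mul_of_nonneg_left b (by linarith)
      have c5 : q * B ≤ q * (binomTail q k σ + k * q ^ 2) :=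
        mul_le_mul_of_nonneg_left a q0
      nlinarith

/-- One success among the first `m` variables and `σ` among the other `k` make `σ + 1`. -/
theorem mul_binomTail_le (h0 : 0 ≤ p) (h1 : p ≤ 1) (m k σ : ℕ) :
    binomTail p m 1 * binomTail p k σ ≤ binomTail p (m + k) (σ + 1) := by
  induction m with
  | zero => simpa using binomTail_nonneg h0 h1 _ _
  | succ m ih =>
    rw [show m + 1 + k = (m + k) + 1 by ring, binomTail_succ_succ, binomTail_succ_succ]
    have := binomTail_mono_left h0 h1 σ (by omega : k ≤ m + k)
    simp only [binomTail_zero_right] at *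
    have : 0 ≤ 1 - p := by linarith
    nlinarith

/-- Cut the `σ * m` variables into `σ` blocks and ask for a success in each. -/
theorem binomTail_mul_ge (h0 : 0 ≤ p) (h1 : p ≤ 1) (m σ : ℕ) :
    (1 - Real.exp (-(p * m))) ^ σ ≤ binomTail p (σ * m) σ := by
  have hm : 1 - Real.exp (-(p * m)) ≤ binomTail p m 1 := by
    rw [binomTail_one]
    have : (1 - p) ^ m ≤ Real.exp (-(p * m)) := by
      rw [show -(p * m) = m * (-p) by ring, Real.exp_nat_mul]
      exact pow_le_pow_left₀ (by linarith) (by linarith [Real.add_one_le_exp (-p)]) _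
    linarith
  have hn : 0 ≤ 1 - Real.exp (-(p * m)) := by
    have : Real.exp (-(p * m)) ≤ 1 := Real.exp_le_one_iff.2 (by simp; positivity)
    linarith
  induction σ with
  | zero => simp
  | succ σ ih =>
    rw [pow_succ', show (σ + 1) * m = m + σ * m by ring]
    refine le_trans ?_ (mul_binomTail_le h0 h1 m (σ * m) σ)
    exact mul_le_mul hm ih (by positivity) (binomTail_nonneg h0 h1 _ _)

/-- A lower bound for binomial tails which is uniform in `p` in terms of `p * k`. -/
theorem binomTail_ge (h0 : 0 ≤ p) (h1 : p ≤ 1) {k σ : ℕ} (hσ : 1 ≤ σ) (hk : σ ≤ k) {x : ℝ}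
    (hx0 : 0 ≤ x) (hx : x ≤ p * k) :
    (1 - Real.exp (-(x / (2 * σ)))) ^ σ ≤ binomTail p k σ := by
  have hd : σ * (k / σ) ≤ k := Nat.mul_div_le k σ
  refine le_trans ?_ (binomTail_mono_left h0 h1 σ hd)
  refine le_trans ?_ (binomTail_mul_ge h0 h1 (k / σ) σ)
  have hσ' : (1 : ℝ) ≤ σ := by exact_mod_cast hσ
  have : Real.exp (-(x / (2 * σ))) ≤ 1 := Real.exp_le_one_iff.2 (by simp; positivity)
  have hkd : (k : ℝ) / (2 * σ) ≤ ((k / σ : ℕ) : ℝ) := by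
    rw [div_le_iff₀ (by positivity)]
    have h1 : 1 ≤ k / σ := (Nat.one_le_div_iff (by omega)).2 hk
    have h2 := Nat.lt_div_mul_add (a := k) (b := σ) (by omega)
    have : k ≤ (k / σ) * (2 * σ) := by nlinarith
    exact_mod_cast this
  have : x / (2 * σ) ≤ p * ((k / σ : ℕ) : ℝ) := by
    calc x / (2 * σ) ≤ p * k / (2 * σ) := by gcongr
      _ = p * (k / (2 * σ)) := by ring
      _ ≤ _ := by gcongr
  gcongr

/-- The domination of binomial tails for `k = σ`, where all the variables must be positive. -/
theorem poissonTail_ge {σ : ℕ} (hσ : 1 ≤ σ) (x : ℝ≥0) :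
    (1 - Real.exp (-(x / σ))) ^ σ ≤ poissonTail σ x := by
  have h1 : Real.exp (-((x / σ : ℝ≥0) : ℝ)) ≤ 1 := Real.exp_le_one_iff.2 (by simp; positivity)
  have h := (pow_le_binomTail_self (p := 1 - Real.exp (-((x / σ : ℝ≥0) : ℝ))) (by linarith)
    (by linarith [Real.exp_pos (-((x / σ : ℝ≥0) : ℝ))]) σ).trans
      (binomTail_le_poissonTail (x / σ) σ σ)
  have e : (σ : ℝ≥0) * (x / σ) = x := by
    field_simp
  rw [e] at h
  simpa using h

theorem poissonTail_le {σ : ℕ} (hσ : 1 ≤ σ) (x : ℝ≥0) : poissonTail σ x ≤ 1 - Real.exp (-x) := by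
  rw [← poissonMeasure_real_Ici_one]
  exact poissonTail_anti x hσ

end Tails

/-! ### The rate function and its truncations -/

theorem poissonRate_eq (σ : ℕ) (x : ℝ) :
    poissonRate σ x = -Real.log (poissonTail σ x.toNNReal) := rfl

theorem one_sub_exp_neg_pos {x : ℝ} (hx : 0 < x) : 0 < 1 - Real.exp (-x) := by
  have : Real.exp (-x) < 1 := Real.exp_lt_one_iff.2 (by linarith)
  linarith

theorem integrableOn_neg_log_one_sub_exp :
    IntegrableOn (fun x : ℝ => -Real.log (1 - Real.exp (-x))) (Ioi 0) := by
  have hm : Measurable (fun x : ℝ => -Real.log (1 - Real.exp (-x))) := by fun_prop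
  have hnn : ∀ x : ℝ, 0 < x → 0 ≤ -Real.log (1 - Real.exp (-x)) := fun x hx => by
    have h1 := one_sub_exp_neg_pos hx
    have := Real.log_nonpos h1.le (by linarith [Real.exp_pos (-x)])
    linarith
  rw [← Ioc_union_Ioi_eq_Ioi (zero_le_one' ℝ)]
  refine IntegrableOn.union ?_ ?_
  -- near `0` the integrand is at most `-log (x / 2)`, beyond `1` it is at most `2 * exp (-x)`
  · have h1 : IntegrableOn (fun x : ℝ => Real.log 2 - Real.log x) (Ioc 0 1) := by
      have := (intervalIntegral.intervalIntegrable_log' (a := 0) (b := 1))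
      rw [intervalIntegrable_iff_integrableOn_Ioc_of_le zero_le_one] at this
      exact (integrableOn_const (by simp)).sub this
    refine Integrable.mono' h1 hm.aestronglyMeasurable ?_
    filter_upwards [ae_restrict_mem measurableSet_Ioc] with x hx
    rw [Real.norm_of_nonneg (hnn x hx.1)]
    have h2 : x / 2 ≤ 1 - Real.exp (-x) := by
      have h := Real.quadratic_le_exp_of_nonneg hx.1.le
      have hp : Real.exp (-x) * Real.exp x = 1 := by rw [← Real.exp_add]; simp
      have h0 := Real.exp_pos (-x)
      nlinarith [hx.1, hx.2]
    have := Real.log_le_log (by linarith [hx.1]) h2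
    rw [Real.log_div hx.1.ne' two_ne_zero] at this
    linarith
  · have h1 : IntegrableOn (fun x : ℝ => 2 * Real.exp (-x)) (Ioi 1) :=
      (integrableOn_exp_neg_Ioi 1).const_mul 2
    refine Integrable.mono' h1 hm.aestronglyMeasurable ?_
    filter_upwards [ae_restrict_mem measurableSet_Ioi] with x hx
    have hx0 : 0 < x := lt_trans one_pos hx
    rw [Real.norm_of_nonneg (hnn x hx0)]
    have hu := one_sub_exp_neg_pos hx0
    have h2 : Real.exp (-x) ≤ 1 / 2 := by
      have h3 : (2:ℝ) ≤ Real.exp x := by linarith [Real.add_one_le_exp x, mem_Ioi.1 hx]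
      have hp : Real.exp (-x) * Real.exp x = 1 := by rw [← Real.exp_add]; simp
      nlinarith [Real.exp_pos (-x)]
    rw [← Real.log_inv]
    refine (Real.log_le_sub_one_of_pos (by positivity)).trans ?_
    rw [sub_le_iff_le_add, inv_le_iff_one_le_mul₀ hu]
    nlinarith [Real.exp_pos (-x)]

/-- The logarithm of the lower bound `(1 - exp (-x / a)) ^ σ` for the tails is integrable. -/
theorem integrableOn_neg_log_one_sub_exp_pow (σ : ℕ) {a : ℝ} (ha : 0 < a) :
    IntegrableOn (fun x : ℝ => -Real.log ((1 - Real.exp (-(x / a))) ^ σ)) (Ioi 0) := by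
  have h := integrableOn_neg_log_one_sub_exp
  have h2 := (integrableOn_Ioi_comp_mul_left_iff
    (fun x : ℝ => -Real.log (1 - Real.exp (-x))) 0 (inv_pos.2 ha)).2 (by simpa using h)
  have h3 := h2.const_mul (σ : ℝ)
  refine IntegrableOn.congr_fun h3 (fun x _ => ?_) measurableSet_Ioi
  simp only [Real.log_pow]
  rw [show a⁻¹ * x = x / a by field_simp]
  ring

theorem poissonTail_pos {σ : ℕ} (hσ : 1 ≤ σ) {x : ℝ≥0} (hx : 0 < x) : 0 < poissonTail σ x := by
  refine lt_of_lt_of_le ?_ (poissonTail_ge hσ x)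
  have : (0:ℝ) < x / σ := by positivity
  exact pow_pos (one_sub_exp_neg_pos this) _

theorem poissonRate_nonneg (σ : ℕ) (x : ℝ) : 0 ≤ poissonRate σ x := by
  rw [poissonRate_eq]
  linarith [Real.log_nonpos (poissonTail_nonneg σ x.toNNReal) (poissonTail_le_one σ x.toNNReal)]

theorem measurable_poissonTail (σ : ℕ) : Measurable (fun x : ℝ => poissonTail σ x.toNNReal) :=
  Monotone.measurable fun _ _ h => poissonTail_mono σ (Real.toNNReal_mono h)

theorem measurable_poissonRate (σ : ℕ) : Measurable (poissonRate σ) :=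
  (Real.measurable_log.comp (measurable_poissonTail σ)).neg

theorem integrableOn_poissonRate {σ : ℕ} (hσ : 1 ≤ σ) :
    IntegrableOn (poissonRate σ) (Ioi 0) := by
  refine Integrable.mono' (integrableOn_neg_log_one_sub_exp_pow σ (a := σ) (by positivity))
    (measurable_poissonRate σ).aestronglyMeasurable ?_
  filter_upwards [ae_restrict_mem measurableSet_Ioi] with x hx
  rw [Real.norm_of_nonneg (poissonRate_nonneg _ _), poissonRate_eq, neg_le_neg_iff]
  have hx' : 0 < x := hx
  have h := poissonTail_ge hσ x.toNNReal
  rw [Real.coe_toNNReal _ hx'.le] at h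
  refine Real.log_le_log (pow_pos (one_sub_exp_neg_pos (by positivity)) _) h

theorem ringConst_pos {σ : ℕ} (hσ : 1 ≤ σ) : 0 < ringConst σ := by
  rw [ringConst, setIntegral_pos_iff_support_of_nonneg_ae]
  · have : Ioi (0:ℝ) ⊆ Function.support (poissonRate σ) ∩ Ioi 0 := by
      intro x hx
      refine ⟨?_, hx⟩
      have hx' : 0 < x := hx
      rw [Function.mem_support, poissonRate_eq]
      have h1 := poissonTail_pos hσ (Real.toNNReal_pos.2 hx')
      have h2 := poissonTail_le hσ x.toNNReal
      have := Real.log_neg h1 (by linarith [Real.exp_pos (-(x.toNNReal : ℝ))])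
      linarith
    refine lt_of_lt_of_le ?_ (measure_mono this)
    simp
  · exact Eventually.of_forall fun x => poissonRate_nonneg σ x
  · exact integrableOn_poissonRate hσ

/-- The rate `-log ℙ(Poisson(x) ≥ σ)` truncated at height `c`. Unlike the rate itself, it has the
right value `c` at `x = 0`. -/
def truncRate (c : ℝ) (σ : ℕ) (x : ℝ) : ℝ :=
  -Real.log (max (Real.exp (-c)) (poissonTail σ x.toNNReal))

theorem truncRate_nonneg {c : ℝ} (hc : 0 ≤ c) (σ : ℕ) (x : ℝ) : 0 ≤ truncRate c σ x := by
  have := Real.log_nonpos (x := max (Real.exp (-c)) (poissonTail σ x.toNNReal))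
    (le_max_of_le_left (Real.exp_pos _).le)
    (max_le (Real.exp_le_one_iff.2 (by linarith)) (poissonTail_le_one _ _))
  rw [truncRate]; linarith

theorem truncRate_le (c : ℝ) (σ : ℕ) (x : ℝ) : truncRate c σ x ≤ c := by
  have := Real.log_le_log (Real.exp_pos (-c)) (le_max_left _ (poissonTail σ x.toNNReal))
  rw [Real.log_exp] at this
  rw [truncRate]; linarith

theorem truncRate_antitone (c : ℝ) (σ : ℕ) : Antitone (truncRate c σ) := by
  intro x y h
  simp only [truncRate, neg_le_neg_iff]
  refine Real.log_le_log (lt_max_of_lt_left (Real.exp_pos _)) (max_le_max le_rfl ?_)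
  exact poissonTail_mono σ (Real.toNNReal_mono h)

theorem exp_neg_truncRate (c : ℝ) (σ : ℕ) (x : ℝ) :
    Real.exp (-truncRate c σ x) = max (Real.exp (-c)) (poissonTail σ x.toNNReal) := by
  rw [truncRate, neg_neg, Real.exp_log (lt_max_of_lt_left (Real.exp_pos _))]

theorem truncRate_le_poissonRate {σ : ℕ} (hσ : 1 ≤ σ) (c : ℝ) {x : ℝ} (hx : 0 < x) :
    truncRate c σ x ≤ poissonRate σ x := by
  rw [truncRate, poissonRate_eq, neg_le_neg_iff]
  exact Real.log_le_log (poissonTail_pos hσ (Real.toNNReal_pos.2 hx)) (le_max_right _ _)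

/-- Truncating the rate at height `m` and its domain at `m` loses little of the integral `λ_σ`. -/
theorem exists_truncRate_integral {σ : ℕ} (hσ : 1 ≤ σ) {η : ℝ} (hη : 0 < η) :
    ∃ m : ℕ, 0 < m ∧ ringConst σ - η ≤ ∫ x in (0:ℝ)..m, truncRate m σ x := by
  have key : Tendsto (fun m : ℕ => ∫ x in Ioi (0:ℝ),
      (Ioc (0:ℝ) m).indicator (truncRate m σ) x) atTop (𝓝 (ringConst σ)) := by
    refine tendsto_integral_of_dominated_convergence (poissonRate σ) (fun m => ?_)
      (integrableOn_poissonRate hσ) (fun m => ?_) ?_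
    · exact ((truncRate_antitone m σ).measurable.indicator measurableSet_Ioc).aestronglyMeasurable
    · filter_upwards [ae_restrict_mem measurableSet_Ioi] with x hx
      by_cases h : x ∈ Ioc (0:ℝ) m
      · rw [indicator_of_mem h, Real.norm_of_nonneg (truncRate_nonneg (by positivity) _ _)]
        exact truncRate_le_poissonRate hσ _ hx
      · rw [indicator_of_notMem h]; simpa using poissonRate_nonneg σ x
    · filter_upwards [ae_restrict_mem measurableSet_Ioi] with x hx
      have hx' : 0 < x := hx
      have hT := poissonTail_pos hσ (Real.toNNReal_pos.2 hx')
      obtain ⟨N, hN⟩ := exists_nat_ge (max x (poissonRate σ x))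
      refine tendsto_const_nhds.congr' ?_
      filter_upwards [eventually_ge_atTop N] with m hm
      have hm' : (N : ℝ) ≤ m := by exact_mod_cast hm
      have hmem : x ∈ Ioc (0:ℝ) m := ⟨hx', (le_max_left _ _).trans (hN.trans hm')⟩
      rw [indicator_of_mem hmem, truncRate, poissonRate_eq,
        max_eq_right]
      rw [← Real.log_le_log_iff (Real.exp_pos _) hT, Real.log_exp]
      have := (le_max_right _ _).trans (hN.trans hm')
      rw [poissonRate_eq] at this
      linarith
  have h1 := (tendsto_order.1 key).1 (ringConst σ - η) (by linarith)
  obtain ⟨m, hm, hm0⟩ := (h1.and (eventually_gt_atTop 0)).exists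
  refine ⟨m, hm0, ?_⟩
  rw [intervalIntegral.integral_of_le (by positivity)]
  rw [integral_indicator measurableSet_Ioc, Measure.restrict_restrict measurableSet_Ioc,
    inter_eq_left.2 (Ioc_subset_Ioi_self)] at hm
  exact hm.le

/-- The cost of `k` vertices, as an upper Riemann sum with mesh `s`. -/
theorem integral_truncRate_le_sum {c : ℝ} (hc : 0 ≤ c) (σ : ℕ) {s M : ℝ} (hs : 0 < s) (hM : 0 ≤ M)
    {k : ℕ} (hk : M ≤ s * k) :
    ∫ x in (0:ℝ)..M, truncRate c σ x ≤ s * ∑ i ∈ Finset.range k, truncRate c σ (s * i) := by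
  have hint : ∀ a b, IntervalIntegrable (truncRate c σ) volume a b := fun a b =>
    (truncRate_antitone c σ).intervalIntegrable
  calc ∫ x in (0:ℝ)..M, truncRate c σ x ≤ ∫ x in (0:ℝ)..(s * k), truncRate c σ x := by
        refine intervalIntegral.integral_mono_interval le_rfl hM hk ?_ (hint _ _)
        exact Eventually.of_forall fun x => truncRate_nonneg hc σ x
    _ = s * ∫ x in (0:ℝ)..(0 + k), truncRate c σ (s * x) := by
        rw [intervalIntegral.integral_comp_mul_left _ hs.ne']
        simp [hs.ne']
    _ ≤ s * ∑ i ∈ Finset.range k, truncRate c σ (s * i) := by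
        gcongr
        have : AntitoneOn (fun x : ℝ => truncRate c σ (s * x)) (Icc 0 (0 + k)) := by
          intro x _ y _ h
          exact truncRate_antitone c σ (by gcongr)
        simpa using this.integral_le_sum

/-! ### The probability that an interval grows -/

/-- A lower bound for `binomTail p k σ` when `k = ⌈x / p⌉ ≥ σ`: it converges to the Poisson tail
as `p → 0`, and its second part keeps its logarithm dominated. -/
def binomTailBound (σ : ℕ) (p x : ℝ) : ℝ :=
  max (poissonTail σ x.toNNReal - p * x - p ^ 2) ((1 - Real.exp (-(x / (2 * σ)))) ^ σ)

theorem binomTailBound_pos {σ : ℕ} (hσ : 1 ≤ σ) (p : ℝ) {x : ℝ} (hx : 0 < x) :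
    0 < binomTailBound σ p x :=
  lt_max_of_lt_right (pow_pos (one_sub_exp_neg_pos (by positivity)) _)

theorem binomTailBound_le_one {σ : ℕ} {p x : ℝ} (hp : 0 ≤ p) (hx : 0 ≤ x) :
    binomTailBound σ p x ≤ 1 := by
  refine max_le ?_ ?_
  · have := poissonTail_le_one σ x.toNNReal
    nlinarith [mul_nonneg hp hx]
  · refine pow_le_one₀ ?_ ?_
    · have : Real.exp (-(x / (2 * σ))) ≤ 1 := Real.exp_le_one_iff.2 (by simp; positivity)
      linarith
    · linarith [Real.exp_pos (-(x / (2 * σ)))]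

theorem measurable_neg_log_binomTailBound (σ : ℕ) (p : ℝ) :
    Measurable fun x => -Real.log (binomTailBound σ p x) := by
  have := measurable_poissonTail σ
  unfold binomTailBound
  fun_prop

theorem norm_neg_log_binomTailBound_le {σ : ℕ} (hσ : 1 ≤ σ) {p x : ℝ} (hp : 0 ≤ p) (hx : 0 < x) :
    ‖-Real.log (binomTailBound σ p x)‖ ≤
      -Real.log ((1 - Real.exp (-(x / (2 * σ)))) ^ σ) := by
  have h := Real.log_nonpos (binomTailBound_pos hσ p hx).le (binomTailBound_le_one hp hx.le)
  rw [Real.norm_of_nonneg (by linarith), neg_le_neg_iff]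
  exact Real.log_le_log (pow_pos (one_sub_exp_neg_pos (by positivity)) _) (le_max_right _ _)

theorem integrableOn_neg_log_binomTailBound {σ : ℕ} (hσ : 1 ≤ σ) {p : ℝ} (hp : 0 ≤ p) :
    IntegrableOn (fun x => -Real.log (binomTailBound σ p x)) (Ioi 0) := by
  refine Integrable.mono' (integrableOn_neg_log_one_sub_exp_pow σ (a := 2 * σ) (by positivity))
    (measurable_neg_log_binomTailBound σ p).aestronglyMeasurable ?_
  filter_upwards [ae_restrict_mem measurableSet_Ioi] with x hx
  exact norm_neg_log_binomTailBound_le hσ hp hx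

theorem tendsto_integral_neg_log_binomTailBound {σ : ℕ} (hσ : 1 ≤ σ) :
    Tendsto (fun p : ℝ => ∫ x in Ioi (0:ℝ), -Real.log (binomTailBound σ p x)) (𝓝[>] 0)
      (𝓝 (ringConst σ)) := by
  refine tendsto_integral_filter_of_dominated_convergence
    (fun x => -Real.log ((1 - Real.exp (-(x / (2 * σ)))) ^ σ)) ?_ ?_
    (integrableOn_neg_log_one_sub_exp_pow σ (a := 2 * σ) (by positivity)) ?_
  · exact Eventually.of_forall fun p =>
      (measurable_neg_log_binomTailBound σ p).aestronglyMeasurable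
  · filter_upwards [self_mem_nhdsWithin] with p hp
    filter_upwards [ae_restrict_mem measurableSet_Ioi] with x hx
    exact norm_neg_log_binomTailBound_le hσ (le_of_lt hp) hx
  · filter_upwards [ae_restrict_mem measurableSet_Ioi] with x hx
    have hx' : 0 < x := hx
    have hT := poissonTail_pos hσ (Real.toNNReal_pos.2 hx')
    have hle : (1 - Real.exp (-(x / (2 * σ)))) ^ σ ≤ poissonTail σ x.toNNReal := by
      refine le_trans ?_ (poissonTail_ge hσ x.toNNReal)
      rw [Real.coe_toNNReal _ hx'.le]
      have h1 := (one_sub_exp_neg_pos (x := x / (2 * σ)) (by positivity)).le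
      have h2 : x / (2 * σ) ≤ x / σ := by
        gcongr
        linarith [(Nat.cast_nonneg σ : (0:ℝ) ≤ σ)]
      gcongr
    rw [poissonRate_eq]
    have h0 : binomTailBound σ 0 x = poissonTail σ x.toNNReal := by
      rw [binomTailBound, max_eq_left] <;> simp [hle]
    have hc : ContinuousAt (fun p => -Real.log (binomTailBound σ p x)) 0 := by
      have h1 : ContinuousAt (fun p => binomTailBound σ p x) 0 := by
        unfold binomTailBound
        fun_prop
      exact (h1.log (by rw [h0]; exact hT.ne')).neg
    have := hc.tendsto
    rw [h0] at this
    exact this.mono_left nhdsWithin_le_nhds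

theorem binomTailBound_le_binomTail {σ : ℕ} (hσ : 1 ≤ σ) {p : ℝ} (hp0 : 0 < p) (hp1 : p ≤ 1)
    {k : ℕ} (hk : σ ≤ k) {x : ℝ} (hx0 : 0 ≤ x) (hx1 : p * (k - 1) ≤ x) (hx2 : x ≤ p * k) :
    binomTailBound σ p x ≤ binomTail p k σ := by
  refine max_le ?_ (binomTail_ge hp0.le hp1 hσ hk hx0 hx2)
  have h := poissonTail_le_binomTail ⟨p, hp0.le⟩ hp1 k σ
  have h2 : poissonTail σ x.toNNReal ≤ poissonTail σ (k * ⟨p, hp0.le⟩) := by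
    refine poissonTail_mono σ ?_
    rw [Real.toNNReal_le_iff_le_coe]
    change x ≤ k * p
    linarith
  change _ ≤ binomTail p k σ + k * p ^ 2 at h
  nlinarith

/-- The cost of the `k`-th vertex is at most the corresponding piece of a Riemann integral. -/
theorem neg_log_binomTail_le_integral {σ : ℕ} (hσ : 1 ≤ σ) {p : ℝ} (hp0 : 0 < p) (hp1 : p ≤ 1)
    {k : ℕ} (hk : σ ≤ k) :
    p * -Real.log (max p (binomTail p k σ)) ≤
      ∫ x in (p * ((k : ℝ) - 1))..(p * (((k + 1 : ℕ) : ℝ) - 1)),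
        -Real.log (binomTailBound σ p x) := by
  have hk1 : (1:ℝ) ≤ k := by exact_mod_cast hσ.trans hk
  have hle : p * ((k : ℝ) - 1) ≤ p * (((k + 1 : ℕ) : ℝ) - 1) := by push_cast; nlinarith
  have h0 : 0 ≤ p * ((k : ℝ) - 1) := mul_nonneg hp0.le (by linarith)
  have e : p * -Real.log (max p (binomTail p k σ)) =
      ∫ x in (p * ((k : ℝ) - 1))..(p * (((k + 1 : ℕ) : ℝ) - 1)),
        -Real.log (max p (binomTail p k σ)) := by
    rw [intervalIntegral.integral_const, smul_eq_mul]; push_cast; ring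
  rw [e, intervalIntegral.integral_of_le hle, intervalIntegral.integral_of_le hle]
  refine setIntegral_mono_on (integrableOn_const (by simp)) ?_ measurableSet_Ioc ?_
  · exact (integrableOn_neg_log_binomTailBound hσ hp0.le).mono_set
      (Ioc_subset_Ioi_self.trans (Ioi_subset_Ioi h0))
  · intro x hx
    have hx0 : 0 < x := lt_of_le_of_lt h0 hx.1
    rw [neg_le_neg_iff]
    refine Real.log_le_log (binomTailBound_pos hσ p hx0) (le_max_of_le_right ?_)
    refine binomTailBound_le_binomTail hσ hp0 hp1 hk hx0.le hx.1.le ?_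
    have := hx.2; push_cast at this; linarith

/-- An interval grows one vertex at a time to any length with probability at least
`exp (-(λ_σ + o(1)) / p)`. -/
theorem eventually_exp_le_prod_binomTail {σ : ℕ} (hσ : 1 ≤ σ) {η : ℝ} (hη : 0 < η) :
    ∀ᶠ p : ℝ in 𝓝[>] 0, ∀ L : ℕ, Real.exp (-(ringConst σ + η) / p) ≤
      ∏ k ∈ Finset.Ico 1 L, max p (binomTail p k σ) := by
  have h1 := (tendsto_order.1 (tendsto_integral_neg_log_binomTailBound hσ)).2
    (ringConst σ + η / 2) (by linarith)
  have h2 : Tendsto (fun p : ℝ => -(σ * (p * Real.log p))) (𝓝[>] 0) (𝓝 0) := by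
    have := (Real.continuous_mul_log.tendsto 0).const_mul (-(σ:ℝ))
    simp only [Real.log_zero, mul_zero] at this
    refine (this.mono_left nhdsWithin_le_nhds).congr fun p => by ring
  have h2' := (tendsto_order.1 h2).2 (η / 2) (by linarith)
  filter_upwards [h1, h2', self_mem_nhdsWithin, Ioo_mem_nhdsGT one_pos] with p h1 h2 hp0 hp1 L
  have hp0 : 0 < p := hp0
  have hp1 : p ≤ 1 := hp1.2.le
  have hr : ∀ k, 0 < max p (binomTail p k σ) := fun k => lt_max_of_lt_left hp0
  have hr1 : ∀ k, max p (binomTail p k σ) ≤ 1 := fun k =>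
    max_le hp1 (binomTail_le_one hp0.le hp1 _ _)
  have hl : ∀ k, 0 ≤ -Real.log (max p (binomTail p k σ)) := fun k => by
    linarith [Real.log_nonpos (hr k).le (hr1 k)]
  rw [← Real.le_log_iff_exp_le (Finset.prod_pos fun k _ => hr k),
    Real.log_prod (fun k _ => (hr k).ne'), div_le_iff₀ hp0]
  -- for `k < σ` only the edge to the last vertex is used, at the negligible total cost
  -- `σ * log (1 / p)`
  have small : ∑ k ∈ Finset.range σ, -Real.log (max p (binomTail p k σ)) ≤ σ * -Real.log p := by
    have : ∀ k ∈ Finset.range σ, -Real.log (max p (binomTail p k σ)) ≤ -Real.log p := fun k _ => by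
      rw [neg_le_neg_iff]; exact Real.log_le_log hp0 (le_max_left _ _)
    simpa using Finset.sum_le_sum this
  have large : ∑ k ∈ Finset.Ico σ (max σ L), p * -Real.log (max p (binomTail p k σ)) ≤
      ringConst σ + η / 2 := by
    have hI : ∀ k ∈ Ico σ (max σ L), IntervalIntegrable
        (fun x => -Real.log (binomTailBound σ p x)) volume
        (p * ((k : ℝ) - 1)) (p * (((k + 1 : ℕ) : ℝ) - 1)) := by
      intro k hk
      have hk1 : (1:ℝ) ≤ k := by exact_mod_cast hσ.trans hk.1
      rw [intervalIntegrable_iff_integrableOn_Ioc_of_le (by push_cast; nlinarith)]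
      exact (integrableOn_neg_log_binomTailBound hσ hp0.le).mono_set
        (Ioc_subset_Ioi_self.trans (Ioi_subset_Ioi (mul_nonneg hp0.le (by linarith))))
    calc ∑ k ∈ Finset.Ico σ (max σ L), p * -Real.log (max p (binomTail p k σ))
        ≤ ∑ k ∈ Finset.Ico σ (max σ L), ∫ x in (p * ((k : ℝ) - 1))..(p * (((k + 1 : ℕ) : ℝ) - 1)),
          -Real.log (binomTailBound σ p x) := Finset.sum_le_sum fun k hk =>
            neg_log_binomTail_le_integral hσ hp0 hp1 (Finset.mem_Ico.1 hk).1
      _ = ∫ x in (p * ((σ : ℝ) - 1))..(p * (((max σ L : ℕ) : ℝ) - 1)),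
          -Real.log (binomTailBound σ p x) :=
        intervalIntegral.sum_integral_adjacent_intervals_Ico
          (a := fun k : ℕ => p * ((k : ℝ) - 1)) (le_max_left _ _) hI
      _ ≤ ∫ x in Ioi (0:ℝ), -Real.log (binomTailBound σ p x) := by
        have h1 : (1:ℝ) ≤ σ := by exact_mod_cast hσ
        rw [intervalIntegral.integral_of_le (by gcongr; exact le_max_left _ _)]
        refine setIntegral_mono_set (integrableOn_neg_log_binomTailBound hσ hp0.le) ?_ ?_
        · filter_upwards [ae_restrict_mem measurableSet_Ioi] with x hx
          have := Real.log_nonpos (binomTailBound_pos hσ p hx).le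
            (binomTailBound_le_one hp0.le (le_of_lt hx))
          simp only [Pi.zero_apply]; linarith
        · exact (Ioc_subset_Ioi_self.trans
            (Ioi_subset_Ioi (mul_nonneg hp0.le (by linarith)))).eventuallyLE
      _ ≤ _ := h1.le
  have hsub : Finset.Ico 1 L ⊆ Finset.range σ ∪ Finset.Ico σ (max σ L) := by
    intro k hk
    simp only [Finset.mem_union, Finset.mem_range, Finset.mem_Ico, lt_max_iff] at hk ⊢
    omega
  have hdis : Disjoint (Finset.range σ) (Finset.Ico σ (max σ L)) := by
    rw [Finset.disjoint_left]; intro k; simp; omega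
  have tot := Finset.sum_le_sum_of_subset_of_nonneg hsub (fun k _ _ => hl k)
  rw [Finset.sum_union hdis] at tot
  rw [Finset.sum_neg_distrib] at tot
  rw [← Finset.mul_sum] at large
  nlinarith

/-! ### Internally solved sets -/

section InternallySolved

variable {V : Type*}

open Classical in
/-- The number of `G`-neighbours of `v` in the finite set `B`. -/
def degIn (G : SimpleGraph V) (v : V) (B : Finset V) : ℕ :=
  (B.filter fun w => G.Adj v w).card

theorem degIn_mono {G G' : SimpleGraph V} {v : V} {B B' : Finset V} (hB : B ⊆ B')
    (h : ∀ w ∈ B, G.Adj v w → G'.Adj v w) : degIn G v B ≤ degIn G' v B' := by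
  classical
  refine Finset.card_le_card fun w hw => ?_
  rw [Finset.mem_filter] at hw ⊢
  exact ⟨hB hw.1, h w hw.1 hw.2⟩

theorem degIn_congr {G G' : SimpleGraph V} {v : V} {B : Finset V}
    (h : ∀ w ∈ B, (G.Adj v w ↔ G'.Adj v w)) : degIn G v B = degIn G' v B :=
  le_antisymm (degIn_mono subset_rfl fun w hw => (h w hw).1)
    (degIn_mono subset_rfl fun w hw => (h w hw).2)

theorem degIn_pos {G : SimpleGraph V} {v : V} {B : Finset V} :
    0 < degIn G v B ↔ ∃ w ∈ B, G.Adj v w := by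
  classical
  rw [degIn, Finset.card_pos]
  simp [Finset.Nonempty]

theorem numNbrs_coe (G : SimpleGraph V) (v : V) (B : Finset V) :
    numNbrs G v (B : Set V) = degIn G v B := by
  classical
  rw [numNbrs, degIn, ← Set.encard_coe_eq_coe_finsetCard]
  congr 1
  ext w
  simp [and_comm]

/-- The merging criteria for the ordered pair `(A, B)`, for finite sets and with `τ = 1` and
`θ = ∞`. -/
def FinLinks (puz G : SimpleGraph V) (σ : ℕ) (A B : Finset V) : Prop :=
  ∃ v ∈ A, (∃ w ∈ B, puz.Adj v w ∧ G.Adj v w) ∨ (σ ≤ degIn G v B ∧ ∃ w ∈ B, puz.Adj v w)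

theorem links_coe (puz G : SimpleGraph V) (σ : ℕ) (A B : Finset V) :
    Links puz G σ 1 ⊤ (A : Set V) (B : Set V) ↔ FinLinks puz G σ A B := by
  have h1 : ∀ v, ((1 : ℕ) : ℕ∞) ≤ (degIn puz v B : ℕ∞) ↔ ∃ w ∈ B, puz.Adj v w := fun v => by
    rw [Nat.cast_le, ← degIn_pos]; rfl
  simp only [Links, numNbrs_coe, FinLinks, h1, Nat.cast_le, top_le_iff, ENat.natCast_ne_top,
    Finset.mem_coe, and_false, exists_false, false_or, and_or_left, exists_or]
  refine or_congr ?_ Iff.rfl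
  constructor
  · rintro ⟨v, hv, w, hw, h, h'⟩
    exact ⟨v, hv, w, hw, h', h⟩
  · rintro ⟨v, hv, w, hw, h, h'⟩
    exact ⟨v, hv, w, hw, h', h⟩

theorem FinLinks.mono {puz G G' : SimpleGraph V} {σ : ℕ} {A A' B B' : Finset V}
    (h : FinLinks puz G σ A B) (hA : A ⊆ A') (hB : B ⊆ B')
    (hG : ∀ v ∈ A, ∀ w ∈ B, G.Adj v w → G'.Adj v w) : FinLinks puz G' σ A' B' := by
  obtain ⟨v, hv, h⟩ := h
  refine ⟨v, hA hv, ?_⟩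
  rcases h with ⟨w, hw, h, h'⟩ | ⟨h, w, hw, h'⟩
  · exact Or.inl ⟨w, hB hw, h, hG v hv w hw h'⟩
  · exact Or.inr ⟨h.trans (degIn_mono hB (hG v hv)), w, hB hw, h'⟩

variable [DecidableEq V]

/-- The sets of vertices which the process can put together two clusters at a time, using only
people edges inside the set. -/
inductive InternallySolved (puz G : SimpleGraph V) (σ : ℕ) : Finset V → Prop
  | singleton (v : V) : InternallySolved puz G σ {v}
  | union {A B : Finset V} : InternallySolved puz G σ A → InternallySolved puz G σ B →
      Disjoint A B → (FinLinks puz G σ A B ∨ FinLinks puz G σ B A) →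
      InternallySolved puz G σ (A ∪ B)

namespace InternallySolved

variable {puz G G' : SimpleGraph V} {σ : ℕ} {A : Finset V}

theorem nonempty (h : InternallySolved puz G σ A) : A.Nonempty := by
  induction h with
  | singleton v => exact Finset.singleton_nonempty v
  | union _ _ _ _ ih _ => exact ih.mono Finset.subset_union_left

theorem mono' (h : InternallySolved puz G σ A)
    (hG : ∀ v ∈ A, ∀ w ∈ A, G.Adj v w → G'.Adj v w) : InternallySolved puz G' σ A := by
  induction h with
  | singleton v => exact .singleton v
  | @union A B _ _ hd hl ihA ihB =>
    have hA := Finset.subset_union_left (s₁ := A) (s₂ := B)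
    have hB := Finset.subset_union_right (s₁ := A) (s₂ := B)
    refine .union (ihA fun v hv w hw => hG v (hA hv) w (hA hw))
      (ihB fun v hv w hw => hG v (hB hv) w (hB hw)) hd ?_
    exact hl.imp
      (fun h => h.mono subset_rfl subset_rfl fun v hv w hw => hG v (hA hv) w (hB hw))
      (fun h => h.mono subset_rfl subset_rfl fun v hv w hw => hG v (hB hv) w (hA hw))

theorem mono (h : InternallySolved puz G σ A) (hG : G ≤ G') : InternallySolved puz G' σ A :=
  h.mono' fun _ _ _ _ h => hG h

theorem congr (hG : ∀ v ∈ A, ∀ w ∈ A, (G.Adj v w ↔ G'.Adj v w)) :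
    InternallySolved puz G σ A ↔ InternallySolved puz G' σ A :=
  ⟨fun h => h.mono' fun v hv w hw => (hG v hv w hw).1,
    fun h => h.mono' fun v hv w hw => (hG v hv w hw).2⟩

theorem insert (h : InternallySolved puz G σ A) {v u : V} (hv : v ∉ A) (hu : u ∈ A)
    (huv : puz.Adj v u) (hG : G.Adj v u ∨ σ ≤ degIn G v A) :
    InternallySolved puz G σ (insert v A) := by
  rw [Finset.insert_eq]
  refine .union (.singleton v) h (by simpa using hv) (Or.inl ⟨v, by simp, ?_⟩)
  exact hG.imp (fun hG => ⟨u, hu, huv, hG⟩) (fun hG => ⟨hG, u, hu, huv⟩)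

/-- When a vertex `v` of an internally solved set first leaves its singleton, it is doubly
connected to another vertex of the set or has `σ` people neighbours there. -/
theorem good (hσ : 1 ≤ σ) (h : InternallySolved puz G σ A) (hA : 2 ≤ A.card) {v : V}
    (hv : v ∈ A) : (∃ u ∈ A, puz.Adj v u ∧ G.Adj v u) ∨ σ ≤ degIn G v A := by
  induction h generalizing v with
  | singleton v => simp at hA
  | @union A B hIA hIB hd hl ihA ihB =>
    have key : ∀ C D : Finset V, InternallySolved puz G σ C → FinLinks puz G σ C D ∨
        FinLinks puz G σ D C → (2 ≤ C.card → ∀ {v}, v ∈ C →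
          (∃ u ∈ C, puz.Adj v u ∧ G.Adj v u) ∨ σ ≤ degIn G v C) → v ∈ C →
        C ⊆ A ∪ B → D ⊆ A ∪ B →
          (∃ u ∈ A ∪ B, puz.Adj v u ∧ G.Adj v u) ∨ σ ≤ degIn G v (A ∪ B) := by
      intro C D hC hl ih hvC hCs hDs
      by_cases h2 : 2 ≤ C.card
      · exact (ih h2 hvC).imp (fun ⟨u, hu, h⟩ => ⟨u, hCs hu, h⟩)
          (fun h => h.trans (degIn_mono hCs fun _ _ h => h))
      · have hc : C.card = 1 := by have := hC.nonempty.card_pos; omega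
        obtain ⟨v', rfl⟩ := Finset.card_eq_one.1 hc
        obtain rfl : v = v' := by simpa using hvC
        rcases hl with ⟨w, hw, h⟩ | ⟨w, hw, h⟩
        · obtain rfl : w = v := by simpa using hw
          rcases h with ⟨u, hu, h⟩ | ⟨h, -⟩
          · exact Or.inl ⟨u, hDs hu, h⟩
          · exact Or.inr (h.trans (degIn_mono hDs fun _ _ h => h))
        · left
          refine ⟨w, hDs hw, ?_⟩
          rcases h with ⟨u, hu, h, h'⟩ | ⟨h, u, hu, h'⟩
          · obtain rfl : u = v := by simpa using hu
            exact ⟨h.symm, h'.symm⟩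
          · obtain rfl : u = v := by simpa using hu
            obtain ⟨u', hu', hadj⟩ := degIn_pos.1 (lt_of_lt_of_le hσ h)
            obtain rfl : u' = u := by simpa using hu'
            exact ⟨h'.symm, hadj.symm⟩
    rcases Finset.mem_union.1 hv with hv | hv
    · exact key A B hIA hl ihA hv Finset.subset_union_left Finset.subset_union_right
    · exact key B A hIB hl.symm ihB hv Finset.subset_union_right Finset.subset_union_left

/-- Following the larger part of the successive mergings, the size at most halves at each step, so
that it cannot avoid `[K, 2K)`. -/
theorem exists_card_mem_Ico (h : InternallySolved puz G σ A) {K : ℕ} (hK : 1 ≤ K)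
    (hA : K ≤ A.card) : ∃ J ⊆ A, InternallySolved puz G σ J ∧ K ≤ J.card ∧ J.card < 2 * K := by
  induction h with
  | singleton v =>
    refine ⟨{v}, subset_rfl, .singleton v, hA, ?_⟩
    simp at hA ⊢; omega
  | @union A B hIA hIB hd hl ihA ihB =>
    by_cases h2 : (A ∪ B).card < 2 * K
    · exact ⟨A ∪ B, subset_rfl, .union hIA hIB hd hl, hA, h2⟩
    · rw [Finset.card_union_of_disjoint hd] at h2
      by_cases h3 : K ≤ A.card
      · obtain ⟨J, hJ, h⟩ := ihA h3
        exact ⟨J, hJ.trans Finset.subset_union_left, h⟩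
      · obtain ⟨J, hJ, h⟩ := ihB (by omega)
        exact ⟨J, hJ.trans Finset.subset_union_right, h⟩

/-- Going back in the history of an internally solved set `I` until its size has dropped by `d`:
either its larger part has lost between `d` and `2 * d` vertices, or two large internally solved
sets make up all but less than `d` vertices of `I`. -/
theorem exists_history {I : Finset V} {d : ℕ} (hI : InternallySolved puz G σ I)
    (hd : d + 1 < I.card) :
    (∃ J ⊆ I, InternallySolved puz G σ J ∧ J.card + d ≤ I.card ∧ I.card ≤ J.card + 2 * d) ∨
    ∃ J₁ J₂, J₁ ⊆ I ∧ J₂ ⊆ I ∧ Disjoint J₁ J₂ ∧ InternallySolved puz G σ J₁ ∧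
      InternallySolved puz G σ J₂ ∧ InternallySolved puz G σ (J₁ ∪ J₂) ∧
      d ≤ J₁.card ∧ d ≤ J₂.card ∧ I.card < J₁.card + J₂.card + d := by
  have main : ∀ J, InternallySolved puz G σ J → J ⊆ I → I.card < J.card + d →
      ((∃ J ⊆ I, InternallySolved puz G σ J ∧ J.card + d ≤ I.card ∧ I.card ≤ J.card + 2 * d) ∨
      ∃ J₁ J₂, J₁ ⊆ I ∧ J₂ ⊆ I ∧ Disjoint J₁ J₂ ∧ InternallySolved puz G σ J₁ ∧
        InternallySolved puz G σ J₂ ∧ InternallySolved puz G σ (J₁ ∪ J₂) ∧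
        d ≤ J₁.card ∧ d ≤ J₂.card ∧ I.card < J₁.card + J₂.card + d) := by
    intro J hJ
    induction hJ with
    | singleton v => intro _ h; simp at h; omega
    | @union A B hIA hIB hdis hl ihA ihB =>
      intro hs hc
      rw [Finset.card_union_of_disjoint hdis] at hc
      have hAs := Finset.subset_union_left.trans hs
      have hBs := Finset.subset_union_right.trans hs
      by_cases hA : I.card < A.card + d
      · exact ihA hAs hA
      by_cases hB : I.card < B.card + d
      · exact ihB hBs hB
      by_cases hA2 : I.card ≤ A.card + 2 * d
      · exact Or.inl ⟨A, hAs, hIA, by omega, hA2⟩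
      by_cases hB2 : I.card ≤ B.card + 2 * d
      · exact Or.inl ⟨B, hBs, hIB, by omega, hB2⟩
      · exact Or.inr ⟨A, B, hAs, hBs, hdis, hIA, hIB, .union hIA hIB hdis hl, by omega, by omega,
          hc⟩
  rcases Nat.eq_zero_or_pos d with rfl | hd0
  · exact Or.inl ⟨I, subset_rfl, hI, by simp, by simp⟩
  · exact main I hI subset_rfl (by omega)

end InternallySolved

end InternallySolved

/-! ### The dynamics in terms of internally solved sets -/

section Solves

variable {V : Type*} {puz G : SimpleGraph V} {σ : ℕ}

theorem step_iff {P : Setoid V} {v w : V} :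
    step puz G σ 1 ⊤ P v w ↔
      (mergeGraph puz G σ 1 ⊤ P).Reachable (Quotient.mk P v) (Quotient.mk P w) := Iff.rfl

theorem le_step (P : Setoid V) : P ≤ step puz G σ 1 ⊤ P := by
  intro v w h
  rw [step_iff, Quotient.sound (s := P) h]

theorem partitionAt_succ (t : ℕ) :
    partitionAt puz G σ 1 ⊤ (t + 1) = step puz G σ 1 ⊤ (partitionAt puz G σ 1 ⊤ t) := by
  rw [partitionAt, Function.iterate_succ_apply']; rfl

theorem partitionAt_mono : Monotone (partitionAt puz G σ 1 ⊤) :=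
  monotone_nat_of_le_succ fun t => by rw [partitionAt_succ]; exact le_step _

variable [Fintype V]

open Classical in
/-- The class of `v` in the partition `P`. -/
def cluster (P : Setoid V) (v : V) : Finset V := Finset.univ.filter fun w => P w v

theorem mem_cluster {P : Setoid V} {v w : V} : w ∈ cluster P v ↔ P w v := by
  simp [cluster]

theorem coe_cluster (P : Setoid V) (v : V) :
    (cluster P v : Set V) = clusterSet P (Quotient.mk P v) := by
  ext w
  simp only [Finset.mem_coe, mem_cluster, clusterSet, Set.mem_ofPred_eq]
  exact (Quotient.eq (r := P)).symm

theorem mergeGraph_adj_mk {P : Setoid V} {v w : V} :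
    (mergeGraph puz G σ 1 ⊤ P).Adj (Quotient.mk P v) (Quotient.mk P w) ↔
      ¬ P v w ∧ (FinLinks puz G σ (cluster P v) (cluster P w) ∨
        FinLinks puz G σ (cluster P w) (cluster P v)) := by
  rw [mergeGraph, SimpleGraph.fromRel_adj, ← coe_cluster, ← coe_cluster, links_coe, links_coe]
  refine and_congr (not_congr ?_) Iff.rfl
  exact Quotient.eq (r := P)

variable [DecidableEq V]

/-- If all classes of `P` are internally solved, so are those of the next partition: a maximal
internally solved union of classes inside a connected component is the whole component. -/
theorem internallySolved_cluster_step {P : Setoid V}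
    (hP : ∀ v, InternallySolved puz G σ (cluster P v)) (v : V) :
    InternallySolved puz G σ (cluster (step puz G σ 1 ⊤ P) v) := by
  classical
  set S := cluster (step puz G σ 1 ⊤ P) v
  -- the internally solved unions of classes of `P` which contain `v` and lie in its component
  let F : Finset (Finset V) := S.powerset.filter fun U =>
    InternallySolved puz G σ U ∧ v ∈ U ∧ ∀ x y, P x y → x ∈ U → y ∈ U
  have hF : F.Nonempty := by
    refine ⟨cluster P v, ?_⟩
    simp only [F, Finset.mem_filter, Finset.mem_powerset]
    refine ⟨fun w hw => ?_, hP v, ?_, fun x y h hx => ?_⟩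
    · rw [mem_cluster] at hw ⊢; exact le_step P hw
    · rw [mem_cluster]
    · rw [mem_cluster] at hx ⊢; exact P.trans (P.symm h) hx
  obtain ⟨U, hU, hmax⟩ := F.exists_max_image Finset.card hF
  simp only [F, Finset.mem_filter, Finset.mem_powerset] at hU
  obtain ⟨hUS, hUI, hvU, hUP⟩ := hU
  suffices U = S by rwa [← this]
  refine Finset.Subset.antisymm hUS fun w hw => ?_
  by_contra hwU
  have hreach : (mergeGraph puz G σ 1 ⊤ P).Reachable (Quotient.mk P v) (Quotient.mk P w) := by
    rw [← step_iff]; exact Setoid.symm' _ (mem_cluster.1 hw)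
  obtain ⟨walk⟩ := hreach
  -- a path from `v` to a missing vertex leaves `U` along an edge between classes `x` and `y`
  obtain ⟨e, -, he1, he2⟩ := walk.exists_boundary_dart
    {Q | ∃ x, Quotient.mk P x = Q ∧ x ∈ U} ⟨v, rfl, hvU⟩ (by
      rintro ⟨x, hx, hxU⟩
      exact hwU (hUP _ _ ((Quotient.eq (r := P)).1 hx) hxU))
  obtain ⟨x, hx, hxU⟩ := he1
  obtain ⟨y, hy⟩ := Quotient.exists_rep e.snd
  have hadj := e.adj
  have hyU : y ∉ U := fun h => he2 ⟨y, hy, h⟩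
  rw [← hx, ← hy] at hadj
  have hxS : step puz G σ 1 ⊤ P x v := mem_cluster.1 (hUS hxU)
  have hyS : y ∈ S := by
    rw [mem_cluster]
    refine Setoid.trans' _ (Setoid.symm' _ ?_) hxS
    rw [step_iff]
    exact hadj.reachable
  rw [mergeGraph_adj_mk] at hadj
  have hdis : Disjoint U (cluster P y) := by
    rw [Finset.disjoint_left]
    intro z hz hzy
    exact hyU (hUP _ _ (mem_cluster.1 hzy) hz)
  have hsubx : cluster P x ⊆ U := fun z hz => hUP _ _ (P.symm (mem_cluster.1 hz)) hxU
  have hmem : U ∪ cluster P y ∈ F := by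
    simp only [F, Finset.mem_filter, Finset.mem_powerset]
    refine ⟨Finset.union_subset hUS fun z hz => ?_, ?_, Finset.mem_union_left _ hvU, ?_⟩
    · rw [mem_cluster] at hz hyS ⊢
      exact Setoid.trans' _ (le_step P hz) hyS
    · refine .union hUI (hP y) hdis (hadj.2.imp (fun h => ?_) (fun h => ?_))
      · exact h.mono hsubx subset_rfl fun _ _ _ _ h => h
      · exact h.mono subset_rfl hsubx fun _ _ _ _ h => h
    · intro a b hab ha
      rw [Finset.mem_union] at ha ⊢
      refine ha.imp (hUP a b hab) fun ha => ?_
      rw [mem_cluster] at ha ⊢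
      exact P.trans (P.symm hab) ha
  have h1 := hmax _ hmem
  rw [Finset.card_union_of_disjoint hdis] at h1
  have h2 := (hP y).nonempty.card_pos
  omega

theorem internallySolved_cluster_partitionAt (t : ℕ) (v : V) :
    InternallySolved puz G σ (cluster (partitionAt puz G σ 1 ⊤ t) v) := by
  induction t generalizing v with
  | zero =>
    have : cluster (partitionAt puz G σ 1 ⊤ 0) v = {v} := by
      ext w
      rw [mem_cluster, Finset.mem_singleton]
      exact Iff.rfl
    rw [this]; exact .singleton v
  | succ t ih => rw [partitionAt_succ]; exact internallySolved_cluster_step ih v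

theorem InternallySolved.exists_partitionAt {A : Finset V} (h : InternallySolved puz G σ A) :
    ∃ t, ∀ v ∈ A, ∀ w ∈ A, partitionAt puz G σ 1 ⊤ t v w := by
  induction h with
  | singleton v =>
    refine ⟨0, fun x hx y hy => ?_⟩
    rw [Finset.mem_singleton] at hx hy
    subst hx; subst hy
    rfl
  | @union A B hIA hIB hd hl ihA ihB =>
    obtain ⟨t₁, h₁⟩ := ihA
    obtain ⟨t₂, h₂⟩ := ihB
    set t := max t₁ t₂
    replace h₁ : ∀ v ∈ A, ∀ w ∈ A, partitionAt puz G σ 1 ⊤ t v w := fun v hv w hw =>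
      partitionAt_mono (le_max_left _ _) (h₁ v hv w hw)
    replace h₂ : ∀ v ∈ B, ∀ w ∈ B, partitionAt puz G σ 1 ⊤ t v w := fun v hv w hw =>
      partitionAt_mono (le_max_right _ _) (h₂ v hv w hw)
    set P := partitionAt puz G σ 1 ⊤ t
    obtain ⟨a, ha⟩ := hIA.nonempty
    obtain ⟨b, hb⟩ := hIB.nonempty
    have hab : step puz G σ 1 ⊤ P a b := by
      by_cases hP : P a b
      · exact le_step P hP
      · rw [step_iff]
        refine SimpleGraph.Adj.reachable (mergeGraph_adj_mk.2 ⟨hP, ?_⟩)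
        have hA : A ⊆ cluster P a := fun x hx => mem_cluster.2 (h₁ x hx a ha)
        have hB : B ⊆ cluster P b := fun x hx => mem_cluster.2 (h₂ x hx b hb)
        exact hl.imp (fun h => h.mono hA hB fun _ _ _ _ h => h)
          (fun h => h.mono hB hA fun _ _ _ _ h => h)
    refine ⟨t + 1, ?_⟩
    rw [partitionAt_succ]
    have hall : ∀ x ∈ A ∪ B, step puz G σ 1 ⊤ P x a := by
      intro x hx
      rcases Finset.mem_union.1 hx with hx | hx
      · exact le_step P (h₁ x hx a ha)
      · exact Setoid.trans' _ (le_step P (h₂ x hx b hb)) (Setoid.symm' _ hab)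
    exact fun x hx y hy => Setoid.trans' _ (hall x hx) (Setoid.symm' _ (hall y hy))

/-- Merging all linked clusters at once or two at a time leads to the same final result. -/
theorem solves_iff [Nonempty V] :
    Solves puz G σ 1 ⊤ ↔ InternallySolved puz G σ Finset.univ := by
  constructor
  · rintro ⟨t, ht⟩
    have h := internallySolved_cluster_partitionAt (puz := puz) (G := G) (σ := σ) t
      (Classical.arbitrary V)
    have e : cluster (partitionAt puz G σ 1 ⊤ t) (Classical.arbitrary V) = Finset.univ := by
      ext w; rw [mem_cluster, ht]; simp
    rwa [e] at h
  · intro h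
    obtain ⟨t, ht⟩ := h.exists_partitionAt
    refine ⟨t, ?_⟩
    rw [Setoid.eq_top_iff]
    exact fun x y => ht x (Finset.mem_univ _) y (Finset.mem_univ _)

end Solves

/-! ### Independence in the random graph -/

section RandomGraph

variable {V : Type*}

/-- The event `A` is determined by which edges of the finite set `E` are present. -/
def DependsOnEdges (E : Finset (Sym2 V)) (A : Set (SimpleGraph V)) : Prop :=
  ∀ ⦃G G' : SimpleGraph V⦄, (∀ e ∈ E, (e ∈ G.edgeSet ↔ e ∈ G'.edgeSet)) → G ∈ A → G' ∈ A

namespace DependsOnEdges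

variable {E F : Finset (Sym2 V)} {A B : Set (SimpleGraph V)}

theorem mono (h : DependsOnEdges E A) (hE : E ⊆ F) : DependsOnEdges F A :=
  fun _ _ hG => h fun e he => hG e (hE he)

theorem inter (hA : DependsOnEdges E A) (hB : DependsOnEdges E B) : DependsOnEdges E (A ∩ B) :=
  fun _ _ hG h => ⟨hA hG h.1, hB hG h.2⟩

theorem compl (hA : DependsOnEdges E A) : DependsOnEdges E Aᶜ :=
  fun _ _ hG h h' => h (hA (fun e he => (hG e he).symm) h')

theorem biInter {ι : Type*} {s : Finset ι} {A : ι → Set (SimpleGraph V)}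
    (hA : ∀ i ∈ s, DependsOnEdges E (A i)) : DependsOnEdges E (⋂ i ∈ s, A i) := by
  intro G G' hG h
  simp only [mem_iInter] at h ⊢
  exact fun i hi => hA i hi hG (h i hi)

end DependsOnEdges

theorem dependsOnEdges_mem (e : Sym2 V) : DependsOnEdges {e} {G : SimpleGraph V | e ∈ G.edgeSet} :=
  fun _ _ hG h => (hG e (Finset.mem_singleton_self e)).1 h

theorem dependsOnEdges_adj (v w : V) : DependsOnEdges {s(v, w)} {G : SimpleGraph V | G.Adj v w} :=
  dependsOnEdges_mem s(v, w)

theorem dependsOnEdges_subset (F : Finset (Sym2 V)) :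
    DependsOnEdges F {G : SimpleGraph V | (F : Set (Sym2 V)) ⊆ G.edgeSet} :=
  fun _ _ hG h e he => (hG e he).1 (h he)

section Star

variable [DecidableEq V]

/-- The edges from `v` to the vertices of `S`. -/
def star (v : V) (S : Finset V) : Finset (Sym2 V) := S.image fun w => s(v, w)

theorem mem_star {v : V} {S : Finset V} {e : Sym2 V} : e ∈ star v S ↔ ∃ w ∈ S, s(v, w) = e := by
  simp [star]

theorem dependsOnEdges_degIn (v : V) (S : Finset V) (σ : ℕ) :
    DependsOnEdges (star v S) {G : SimpleGraph V | σ ≤ degIn G v S} := by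
  intro G G' hG h
  rw [mem_ofPred_eq] at h ⊢
  rwa [← degIn_congr (G := G) (G' := G') fun w hw => hG s(v, w) (mem_star.2 ⟨w, hw, rfl⟩)]

theorem dependsOnEdges_internallySolved (puz : SimpleGraph V) (σ : ℕ) (S : Finset V) :
    DependsOnEdges S.sym2 {G : SimpleGraph V | InternallySolved puz G σ S} :=
  fun _ _ hG h => (InternallySolved.congr fun v hv w hw =>
    hG s(v, w) (Finset.mk_mem_sym2_iff.2 ⟨hv, hw⟩)).1 h

end Star

theorem degIn_insert [DecidableEq V] {G : SimpleGraph V} {v u : V} {S : Finset V} (hu : u ∉ S)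
    (k : ℕ) : k + 1 ≤ degIn G v (insert u S) ↔
      (G.Adj v u ∧ k ≤ degIn G v S) ∨ (¬ G.Adj v u ∧ k + 1 ≤ degIn G v S) := by
  classical
  rw [degIn, Finset.filter_insert]
  by_cases h : G.Adj v u
  · rw [if_pos h, Finset.card_insert_of_notMem (by simp [hu])]
    simp [h, degIn]
  · simp [h, degIn]

/-- The graph whose edges are the potential edges `e` with `f e`. -/
def graphOf (f : Sym2 V → Prop) : SimpleGraph V := SimpleGraph.fromEdgeSet {e | f e}

theorem measurable_graphOf : Measurable (graphOf (V := V)) :=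
  SimpleGraph.measurable_fromEdgeSet.comp MeasurableEquiv.setOfPred.measurable

theorem DependsOnEdges.preimage_graphOf {E : Finset (Sym2 V)} {A : Set (SimpleGraph V)}
    (hA : DependsOnEdges E A) : graphOf ⁻¹' A =
      (fun (f : Sym2 V → Prop) (i : E) => f i) ⁻¹'
        ((fun (f : Sym2 V → Prop) (i : E) => f i) '' (graphOf ⁻¹' A)) := by
  refine subset_antisymm (subset_preimage_image _ _) ?_
  rintro f ⟨f', hf', he⟩
  refine hA (fun e he' => ?_) hf'
  have : f' e = f e := congrFun he ⟨e, he'⟩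
  simp [graphOf, SimpleGraph.edgeSet_fromEdgeSet, this]

variable [Fintype V] {p : unitInterval}

instance : MeasurableSingletonClass (SimpleGraph V) where
  measurableSet_singleton G := by
    have : ({G} : Set (SimpleGraph V)) = SimpleGraph.edgeSet ⁻¹' {G.edgeSet} := by
      ext G'; simp
    rw [this]
    exact SimpleGraph.measurable_edgeSet (measurableSet_singleton _)

theorem measurableSet_graphs (A : Set (SimpleGraph V)) : MeasurableSet A :=
  (Set.toFinite A).measurableSet

/-- The law of the indicator of a single potential edge. -/
def edgeLaw (V : Type*) (p : unitInterval) (e : Sym2 V) : Measure Prop :=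
  unitInterval.toNNReal p • Measure.dirac (e ∈ (Sym2.diagSetᶜ : Set (Sym2 V))) +
    unitInterval.toNNReal (unitInterval.symm p) • Measure.dirac False

instance (e : Sym2 V) : IsProbabilityMeasure (edgeLaw V p e) := by
  unfold edgeLaw; infer_instance

theorem binomialRandom_eq_map_infinitePi :
    SimpleGraph.binomialRandom V p = (Measure.infinitePi (edgeLaw V p)).map graphOf := by
  rw [SimpleGraph.binomialRandom_eq_map, setBernoulli_eq_map, Measure.map_map (by fun_prop)]
  · rfl
  · exact MeasurableEquiv.setOfPred.measurable

theorem binomialRandom_real_apply (A : Set (SimpleGraph V)) :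
    (SimpleGraph.binomialRandom V p).real A =
      (Measure.infinitePi (edgeLaw V p)).real (graphOf ⁻¹' A) := by
  rw [binomialRandom_eq_map_infinitePi, measureReal_def, measureReal_def,
    Measure.map_apply measurable_graphOf (measurableSet_graphs A)]

/-- Events which depend on disjoint sets of edges are independent. -/
theorem binomialRandom_real_inter [DecidableEq V] {E F : Finset (Sym2 V)}
    {A B : Set (SimpleGraph V)}
    (hA : DependsOnEdges E A) (hB : DependsOnEdges F B) (h : Disjoint E F) :
    (SimpleGraph.binomialRandom V p).real (A ∩ B) =
      (SimpleGraph.binomialRandom V p).real A * (SimpleGraph.binomialRandom V p).real B := by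
  have hi : iIndepFun (fun (e : Sym2 V) (f : Sym2 V → Prop) => f e)
      (Measure.infinitePi (edgeLaw V p)) :=
    iIndepFun_infinitePi (X := fun _ x => x) (fun _ => measurable_id)
  have hind := hi.indepFun_finset E F h (fun e => measurable_pi_apply e)
  rw [binomialRandom_real_apply, binomialRandom_real_apply, binomialRandom_real_apply,
    preimage_inter, hA.preimage_graphOf, hB.preimage_graphOf, measureReal_def,
    hind.measure_inter_preimage_eq_mul _ _ (Set.toFinite _).measurableSet
      (Set.toFinite _).measurableSet, ENNReal.toReal_mul]
  rfl

theorem binomialRandom_real_biInter [DecidableEq V] {ι : Type*} (s : Finset ι)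
    {E : ι → Finset (Sym2 V)}
    {A : ι → Set (SimpleGraph V)} (hA : ∀ i ∈ s, DependsOnEdges (E i) (A i))
    (hE : (s : Set ι).PairwiseDisjoint E) :
    (SimpleGraph.binomialRandom V p).real (⋂ i ∈ s, A i) =
      ∏ i ∈ s, (SimpleGraph.binomialRandom V p).real (A i) := by
  classical
  induction s using Finset.induction_on with
  | empty => simp
  | insert a s ha ih =>
    rw [Finset.set_biInter_insert, Finset.prod_insert ha,
      ← ih (fun i hi => hA i (Finset.mem_insert_of_mem hi))
        (hE.subset (by simp))]
    refine binomialRandom_real_inter (F := s.biUnion E) (hA a (Finset.mem_insert_self a s))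
      (.biInter fun i hi => (hA i (Finset.mem_insert_of_mem hi)).mono
        (Finset.subset_biUnion_of_mem E hi)) ?_
    rw [Finset.disjoint_biUnion_right]
    exact fun i hi => hE (by simp) (by simp [hi]) (by rintro rfl; exact ha hi)

theorem binomialRandom_real_mem_edgeSet {e : Sym2 V} (he : ¬ e.IsDiag) :
    (SimpleGraph.binomialRandom V p).real {G | e ∈ G.edgeSet} = p := by
  rw [binomialRandom_real_apply]
  have : graphOf ⁻¹' {G : SimpleGraph V | e ∈ G.edgeSet} =
      (fun f : Sym2 V → Prop => f e) ⁻¹' {True} := by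
    ext f
    simp [graphOf, SimpleGraph.edgeSet_fromEdgeSet, he]
  rw [this, measureReal_def, ← Measure.map_apply (measurable_pi_apply e) (measurableSet_singleton _),
    Measure.infinitePi_map_eval]
  simp [edgeLaw, he]

theorem binomialRandom_real_adj {v w : V} (h : v ≠ w) :
    (SimpleGraph.binomialRandom V p).real {G | G.Adj v w} = p :=
  binomialRandom_real_mem_edgeSet (e := s(v, w)) (by simpa using h)

theorem binomialRandom_real_subset [DecidableEq V] {F : Finset (Sym2 V)}
    (hF : ∀ e ∈ F, ¬ e.IsDiag) :
    (SimpleGraph.binomialRandom V p).real {G | (F : Set (Sym2 V)) ⊆ G.edgeSet} = p ^ F.card := by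
  have : {G : SimpleGraph V | (F : Set (Sym2 V)) ⊆ G.edgeSet} =
      ⋂ e ∈ F, {G : SimpleGraph V | e ∈ G.edgeSet} := by
    ext G; simp [Set.subset_def]
  rw [this, binomialRandom_real_biInter F (E := fun e => {e}) (fun e _ => dependsOnEdges_mem e)]
  · rw [Finset.prod_congr rfl fun e he => binomialRandom_real_mem_edgeSet (hF e he)]
    simp
  · intro e _ e' _ h
    simpa using h

theorem binomialRandom_real_degIn [DecidableEq V] {v : V} {S : Finset V} (hv : v ∉ S) (σ : ℕ) :
    (SimpleGraph.binomialRandom V p).real {G | σ ≤ degIn G v S} = binomTail p S.card σ := by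
  induction S using Finset.induction_on generalizing σ with
  | empty =>
    cases σ with
    | zero => simp
    | succ σ => simp [degIn]
  | insert u S hu ih =>
    have hv' : v ∉ S := fun h => hv (Finset.mem_insert_of_mem h)
    have hvu : v ≠ u := by rintro rfl; exact hv (Finset.mem_insert_self _ _)
    rw [Finset.card_insert_of_notMem hu]
    cases σ with
    | zero => simp
    | succ σ =>
      have e : {G : SimpleGraph V | σ + 1 ≤ degIn G v (insert u S)} =
          ({G | G.Adj v u} ∩ {G | σ ≤ degIn G v S}) ∪
            ({G | G.Adj v u}ᶜ ∩ {G | σ + 1 ≤ degIn G v S}) := by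
        ext G
        exact degIn_insert hu σ
      have hd : Disjoint {s(v, u)} (star v S) := by
        rw [Finset.disjoint_singleton_left, mem_star]
        rintro ⟨w, hw, h⟩
        rw [Sym2.congr_right] at h
        exact hu (h ▸ hw)
      have hc : (SimpleGraph.binomialRandom V p).real {G | G.Adj v u}ᶜ = 1 - p := by
        rw [probReal_compl_eq_one_sub (measurableSet_graphs _), binomialRandom_real_adj hvu]
      rw [e, measureReal_union _ (measurableSet_graphs _),
        binomialRandom_real_inter (dependsOnEdges_adj v u) (dependsOnEdges_degIn v S σ) hd,
        binomialRandom_real_inter (dependsOnEdges_adj v u).compl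
          (dependsOnEdges_degIn v S (σ + 1)) hd, ih hv', ih hv', hc, binomialRandom_real_adj hvu,
        binomTail_succ_succ]
      exact Disjoint.mono inter_subset_left inter_subset_left disjoint_compl_right

end RandomGraph

/-! ### The cost of the vertices added to a set -/

section GoodVertices

variable {V : Type*}

theorem disjoint_sym2 {J T : Finset V} (h : Disjoint J T) : Disjoint J.sym2 T.sym2 := by
  rw [Finset.disjoint_left]
  intro e
  induction e using Sym2.ind with
  | _ a b =>
    intro h1 h2
    exact Finset.disjoint_left.1 h (Finset.mk_mem_sym2_iff.1 h1).1 (Finset.mk_mem_sym2_iff.1 h2).1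

open Classical in
/-- The vertices of `T` with a puzzle neighbour in `J`. -/
def outerBoundary (puz : SimpleGraph V) (J T : Finset V) : Finset V :=
  T.filter fun v => ∃ u ∈ J, puz.Adj v u

theorem mem_outerBoundary {puz : SimpleGraph V} {J T : Finset V} {v : V} :
    v ∈ outerBoundary puz J T ↔ v ∈ T ∧ ∃ u ∈ J, puz.Adj v u := by
  simp [outerBoundary]

variable [DecidableEq V]

theorem card_filter_mem_sym2_le (T : Finset V) (e : Sym2 V) [DecidablePred (· ∈ e)] :
    (T.filter fun v => v ∈ e).card ≤ 2 := by
  obtain ⟨⟨a, b⟩, rfl⟩ := Quot.exists_rep e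
  refine (Finset.card_le_card (t := {a, b}) fun v hv => ?_).trans Finset.card_le_two
  rw [Finset.mem_insert, Finset.mem_singleton]
  exact Sym2.mem_iff.1 (Finset.mem_filter.1 hv).2

theorem disjoint_sym2_star {J S : Finset V} {v : V} (hv : v ∉ J) :
    Disjoint J.sym2 (star v S) := by
  rw [Finset.disjoint_left]
  intro e he he'
  obtain ⟨w, -, rfl⟩ := mem_star.1 he'
  exact hv (Finset.mk_mem_sym2_iff.1 he).1

theorem disjoint_star {S S' : Finset V} {v v' : V} (h : v ≠ v') (hv : v ∉ S') :
    Disjoint (star v S) (star v' S') := by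
  rw [Finset.disjoint_left]
  intro e he he'
  obtain ⟨w, hw, rfl⟩ := mem_star.1 he
  obtain ⟨w', hw', h'⟩ := mem_star.1 he'
  rcases Sym2.eq_iff.1 h' with ⟨h1, -⟩ | ⟨-, h2⟩
  · exact h h1.symm
  · exact hv (h2 ▸ hw')

variable [Fintype V] {p : unitInterval}

/-- Let `A` be an event which depends only on the edges inside `J`. The vertices of `T \ D` which
have no neighbour in `T` must have `σ` neighbours in `J`, independently of each other and of `A`.
The edges inside `T` are dealt with by a union bound over the set `F` of those present, each
sparing at most two vertices this requirement. -/
theorem binomialRandom_real_inter_good_le {J T D : Finset V} (hJT : Disjoint J T) {σ : ℕ}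
    {A : Set (SimpleGraph V)} (hA : DependsOnEdges J.sym2 A) {q : ℝ} (hq0 : 0 < q) (hq1 : q ≤ 1)
    (hq : binomTail p J.card σ ≤ q) :
    (SimpleGraph.binomialRandom V p).real
        (A ∩ {G | ∀ v ∈ T \ D, (∃ u ∈ T, G.Adj v u) ∨ σ ≤ degIn G v J}) ≤
      (SimpleGraph.binomialRandom V p).real A *
        (q ^ T.card / q ^ D.card * (1 + p / q ^ 2) ^ (T.card ^ 2)) := by
  classical
  set μ := SimpleGraph.binomialRandom V p
  set Pr := T.sym2.filter fun e => ¬ e.IsDiag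
  let U : Finset (Sym2 V) → Finset V := fun F => (T \ D).filter fun v => ∀ e ∈ F, v ∉ e
  have hp0 : (0 : ℝ) ≤ p := p.2.1
  have hUT : ∀ F, ∀ v ∈ U F, v ∈ T := fun F v hv =>
    (Finset.mem_sdiff.1 (Finset.mem_filter.1 hv).1).1
  have hsub : A ∩ {G | ∀ v ∈ T \ D, (∃ u ∈ T, G.Adj v u) ∨ σ ≤ degIn G v J} ⊆
      ⋃ F ∈ Pr.powerset, A ∩ ({G | (F : Set (Sym2 V)) ⊆ G.edgeSet} ∩
        ⋂ v ∈ U F, {G | σ ≤ degIn G v J}) := by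
    rintro G ⟨hGA, hG⟩
    simp only [mem_iUnion, mem_inter_iff, mem_iInter]
    refine ⟨Pr.filter (· ∈ G.edgeSet), Finset.mem_powerset.2 (Finset.filter_subset _ _), hGA, ?_,
      fun v hv => ?_⟩
    · intro e he
      exact (Finset.mem_filter.1 he).2
    · obtain ⟨hvT, hv2⟩ := Finset.mem_filter.1 hv
      rcases hG v hvT with ⟨u, hu, huv⟩ | h
      · refine absurd (Sym2.mem_mk_left v u) (hv2 s(v, u) ?_)
        simp only [Pr, Finset.mem_filter, Finset.mk_mem_sym2_iff]
        exact ⟨⟨⟨(Finset.mem_sdiff.1 hvT).1, hu⟩, by simpa using huv.ne⟩, huv⟩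
      · exact h
  have hcard : ∀ F, T.card ≤ (U F).card + D.card + 2 * F.card := by
    intro F
    have h1 : T ⊆ (U F ∪ D) ∪ F.biUnion fun e => T.filter fun v => v ∈ e := by
      intro v hv
      simp only [U, Finset.mem_union, Finset.mem_filter, Finset.mem_sdiff, Finset.mem_biUnion]
      by_cases hD : v ∈ D
      · exact Or.inl (Or.inr hD)
      · by_cases h : ∀ e ∈ F, v ∉ e
        · exact Or.inl (Or.inl ⟨⟨hv, hD⟩, h⟩)
        · push Not at h
          obtain ⟨e, he, hve⟩ := h
          exact Or.inr ⟨e, he, hv, hve⟩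
    have h2 := Finset.card_biUnion_le_card_mul F (fun e => T.filter fun v => v ∈ e) 2
      (fun e _ => card_filter_mem_sym2_le T e)
    have h3 := Finset.card_le_card h1
    have h4 := Finset.card_union_le (U F ∪ D) (F.biUnion fun e => T.filter fun v => v ∈ e)
    have h5 := Finset.card_union_le (U F) D
    omega
  have hone : ∀ F ∈ Pr.powerset, μ.real (A ∩ ({G | (F : Set (Sym2 V)) ⊆ G.edgeSet} ∩
      ⋂ v ∈ U F, {G | σ ≤ degIn G v J})) ≤
        μ.real A * (q ^ T.card / q ^ D.card * (p / q ^ 2) ^ F.card) := by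
    intro F hF
    have hF := Finset.mem_powerset.1 hF
    have hFT : F ⊆ T.sym2 := hF.trans (Finset.filter_subset _ _)
    have hstar : ∀ v ∈ U F, v ∉ J := fun v hv hJ =>
      Finset.disjoint_left.1 hJT hJ (hUT F v hv)
    have hFs : ∀ v, Disjoint F (star v J) := by
      intro v
      rw [Finset.disjoint_left]
      intro e he he'
      obtain ⟨w, hw, rfl⟩ := mem_star.1 he'
      exact Finset.disjoint_left.1 hJT hw (Finset.mk_mem_sym2_iff.1 (hFT he)).2
    have hdep : DependsOnEdges ((U F).biUnion fun v => star v J)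
        (⋂ v ∈ U F, {G : SimpleGraph V | σ ≤ degIn G v J}) :=
      .biInter fun v hv => (dependsOnEdges_degIn v J σ).mono
        (Finset.subset_biUnion_of_mem (fun v => star v J) hv)
    have hdF : Disjoint F ((U F).biUnion fun v => star v J) := by
      rw [Finset.disjoint_biUnion_right]
      exact fun v _ => hFs v
    have e1 : μ.real (⋂ v ∈ U F, {G | σ ≤ degIn G v J}) = binomTail p J.card σ ^ (U F).card := by
      rw [binomialRandom_real_biInter (U F) (fun v _ => dependsOnEdges_degIn v J σ)]
      · rw [Finset.prod_congr rfl fun v hv => binomialRandom_real_degIn (hstar v hv) σ]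
        simp
      · intro v hv v' hv' h
        exact disjoint_star h (hstar v hv)
    rw [binomialRandom_real_inter (F := F ∪ (U F).biUnion fun v => star v J) hA
        (((dependsOnEdges_subset F).mono Finset.subset_union_left).inter
          (hdep.mono Finset.subset_union_right)),
      binomialRandom_real_inter (dependsOnEdges_subset F) hdep hdF, e1,
      binomialRandom_real_subset (fun e he => (Finset.mem_filter.1 (hF he)).2)]
    · refine mul_le_mul_of_nonneg_left ?_ measureReal_nonneg
      have hb : binomTail p J.card σ ^ (U F).card ≤ q ^ (U F).card :=
        pow_le_pow_left₀ (binomTail_nonneg hp0 p.2.2 _ _) hq _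
      have hqq : q ^ (U F).card * (q ^ D.card * (q ^ 2) ^ F.card) ≤ q ^ T.card := by
        rw [← pow_mul, ← pow_add, ← pow_add]
        exact pow_le_pow_of_le_one hq0.le hq1 (by have := hcard F; omega)
      calc (p : ℝ) ^ F.card * binomTail p J.card σ ^ (U F).card
          ≤ (p : ℝ) ^ F.card * q ^ (U F).card := by gcongr
        _ ≤ (p : ℝ) ^ F.card * (q ^ T.card / (q ^ D.card * (q ^ 2) ^ F.card)) := by
            gcongr
            rwa [le_div_iff₀ (by positivity)]
        _ = _ := by rw [div_pow]; field_simp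
    · rw [Finset.disjoint_union_right, Finset.disjoint_biUnion_right]
      exact ⟨(disjoint_sym2 hJT).mono_right hFT, fun v hv => disjoint_sym2_star (hstar v hv)⟩
  have hPr : Pr.card ≤ T.card ^ 2 := by
    refine (Finset.card_filter_le _ _).trans ?_
    rw [Finset.card_sym2, Nat.choose_two_right]
    refine Nat.div_le_of_le_mul ?_
    simp only [Nat.add_sub_cancel]
    rcases Nat.eq_zero_or_pos T.card with h | h
    · simp [h]
    · nlinarith
  calc _ ≤ μ.real (⋃ F ∈ Pr.powerset, A ∩ ({G | (F : Set (Sym2 V)) ⊆ G.edgeSet} ∩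
        ⋂ v ∈ U F, {G | σ ≤ degIn G v J})) := measureReal_mono hsub (measure_ne_top _ _)
    _ ≤ ∑ F ∈ Pr.powerset, μ.real (A ∩ ({G | (F : Set (Sym2 V)) ⊆ G.edgeSet} ∩
        ⋂ v ∈ U F, {G | σ ≤ degIn G v J})) := measureReal_biUnion_finset_le _ _
    _ ≤ ∑ F ∈ Pr.powerset, μ.real A * (q ^ T.card / q ^ D.card * (p / q ^ 2) ^ F.card) :=
        Finset.sum_le_sum hone
    _ = μ.real A * (q ^ T.card / q ^ D.card * (1 + p / q ^ 2) ^ Pr.card) := by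
        have := Finset.sum_pow_mul_eq_add_pow (p / q ^ 2 : ℝ) 1 Pr
        simp only [one_pow, mul_one] at this
        rw [← Finset.mul_sum, ← Finset.mul_sum, this, add_comm]
    _ ≤ _ := by
        have : 1 ≤ 1 + p / q ^ 2 := by
          have : 0 ≤ p / q ^ 2 := by positivity
          linarith
        gcongr

end GoodVertices

/-! ### Arcs of the ring -/

section Arcs

variable {V : Type*} [DecidableEq V]

/-- The arc `{a, s a, …, s^(k-1) a}`. -/
def arc (s : Equiv.Perm V) (a : V) (k : ℕ) : Finset V := (Finset.range k).image fun i => s^[i] a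

theorem mem_arc {s : Equiv.Perm V} {a v : V} {k : ℕ} :
    v ∈ arc s a k ↔ ∃ i < k, s^[i] a = v := by
  simp [arc]

theorem arc_union (s : Equiv.Perm V) (a : V) (k l : ℕ) :
    arc s a k ∪ arc s (s^[k] a) l = arc s a (k + l) := by
  ext v
  simp only [Finset.mem_union, mem_arc]
  constructor
  · rintro (⟨i, hi, rfl⟩ | ⟨i, hi, rfl⟩)
    · exact ⟨i, by omega, rfl⟩
    · exact ⟨i + k, by omega, Function.iterate_add_apply ..⟩
  · rintro ⟨i, hi, rfl⟩
    by_cases h : i < k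
    · exact Or.inl ⟨i, h, rfl⟩
    · refine Or.inr ⟨i - k, by omega, ?_⟩
      rw [← Function.iterate_add_apply]; congr 1; omega

theorem eq_of_mem_arc_of_notMem {s : Equiv.Perm V} {a v : V} {k : ℕ} (h : v ∈ arc s a k)
    (h' : s v ∉ arc s a k) : s v = s^[k] a := by
  obtain ⟨i, hi, rfl⟩ := mem_arc.1 h
  rw [← Function.iterate_succ_apply' s i a] at h' ⊢
  by_cases hk : i + 1 < k
  · exact absurd (mem_arc.2 ⟨i + 1, hk, rfl⟩) h'
  · rw [show k = i + 1 by omega]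

theorem eq_of_notMem_of_mem_arc {s : Equiv.Perm V} {a v : V} {k : ℕ} (h : v ∉ arc s a k)
    (h' : s v ∈ arc s a k) : s v = a := by
  obtain ⟨i, hi, h1⟩ := mem_arc.1 h'
  cases i with
  | zero => exact h1.symm
  | succ i =>
    rw [Function.iterate_succ_apply'] at h1
    exact absurd (mem_arc.2 ⟨i, by omega, s.injective h1⟩) h

variable {puz G : SimpleGraph V} {σ : ℕ} {s : Equiv.Perm V}

/-- If puzzle edges only join vertices consecutive for `s`, internally solved sets are arcs. -/
theorem InternallySolved.exists_eq_arc (hs : ∀ u v, puz.Adj u v → v = s u ∨ u = s v)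
    {A : Finset V} (h : InternallySolved puz G σ A) : ∃ a ∈ A, A = arc s a A.card := by
  induction h with
  | singleton v => exact ⟨v, by simp, by simp [arc]⟩
  | @union A B hIA hIB hd hl ihA ihB =>
    have hadj : ∀ C D : Finset V, FinLinks puz G σ C D → ∃ v ∈ C, ∃ w ∈ D, puz.Adj v w := by
      rintro C D ⟨v, hv, ⟨w, hw, h, -⟩ | ⟨-, w, hw, h⟩⟩ <;> exact ⟨v, hv, w, hw, h⟩
    have hadj' : ∃ v ∈ A, ∃ w ∈ B, w = s v ∨ v = s w := by
      rcases hl with h | h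
      · obtain ⟨v, hv, w, hw, h⟩ := hadj _ _ h
        exact ⟨v, hv, w, hw, hs v w h⟩
      · obtain ⟨v, hv, w, hw, h⟩ := hadj _ _ h
        exact ⟨w, hw, v, hv, (hs v w h).symm⟩
    have key : ∀ A B : Finset V, Disjoint A B → (∃ a ∈ A, A = arc s a A.card) →
        (∃ b ∈ B, B = arc s b B.card) → ∀ v ∈ A, s v ∈ B →
          ∃ a ∈ A, A ∪ B = arc s a (A ∪ B).card := by
      rintro A B hd ⟨a, ha, hA⟩ ⟨b, hb, hB⟩ v hv hsv
      have h1 : s v ∉ A := fun h => Finset.disjoint_left.1 hd h hsv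
      have h2 : v ∉ B := fun h => Finset.disjoint_left.1 hd hv h
      rw [hA] at hv h1
      rw [hB] at hsv h2
      have h3 := eq_of_mem_arc_of_notMem hv h1
      have h4 := eq_of_notMem_of_mem_arc h2 hsv
      refine ⟨a, ha, ?_⟩
      rw [Finset.card_union_of_disjoint hd, ← arc_union, ← hA, ← h3, h4, ← hB]
    obtain ⟨v, hv, w, hw, h | h⟩ := hadj'
    · obtain ⟨a, ha, h⟩ := key A B hd ihA ihB v hv (h ▸ hw)
      exact ⟨a, Finset.mem_union_left _ ha, h⟩
    · obtain ⟨a, ha, h⟩ := key B A hd.symm ihB ihA w hw (h ▸ hv)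
      refine ⟨a, Finset.mem_union_right _ ha, ?_⟩
      rwa [Finset.union_comm]

theorem card_outerBoundary_le (hs : ∀ u v, puz.Adj u v → v = s u ∨ u = s v) {J T : Finset V}
    (hJT : Disjoint J T) (hJ : ∃ a k, J = arc s a k) : (outerBoundary puz J T).card ≤ 2 := by
  obtain ⟨a, k, rfl⟩ := hJ
  refine (Finset.card_le_card (t := {s^[k] a, s.symm a}) fun v hv => ?_).trans Finset.card_le_two
  obtain ⟨hvT, u, hu, huv⟩ := mem_outerBoundary.1 hv
  have hvJ : v ∉ arc s a k := fun h => Finset.disjoint_left.1 hJT h hvT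
  rw [Finset.mem_insert, Finset.mem_singleton]
  rcases hs v u huv with rfl | rfl
  · right
    rw [← eq_of_notMem_of_mem_arc hvJ hu, Equiv.symm_apply_apply]
  · left
    exact eq_of_mem_arc_of_notMem hu hvJ

/-- The arcs `arc s a k` with `a ∈ I` and `k ≤ #I`. -/
def subarcs (s : Equiv.Perm V) (I : Finset V) : Finset (Finset V) :=
  (I ×ˢ Finset.range (I.card + 1)).image fun x => arc s x.1 x.2

theorem card_subarcs_le (s : Equiv.Perm V) (I : Finset V) :
    (subarcs s I).card ≤ I.card * (I.card + 1) := by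
  refine Finset.card_image_le.trans ?_
  simp

theorem InternallySolved.mem_subarcs
    (hs : ∀ u v, puz.Adj u v → v = s u ∨ u = s v) {I J : Finset V} (hJI : J ⊆ I)
    (hJ : InternallySolved puz G σ J) : J ∈ subarcs s I := by
  obtain ⟨a, ha, h⟩ := hJ.exists_eq_arc hs
  refine Finset.mem_image.2 ⟨(a, J.card), ?_, h.symm⟩
  rw [Finset.mem_product, Finset.mem_range]
  exact ⟨hJI ha, Nat.lt_succ_of_le (Finset.card_le_card hJI)⟩

/-- The consequence of `InternallySolved.good` for a subset `J` of an internally solved set `I`. -/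
theorem InternallySolved.good_sdiff (hσ : 1 ≤ σ) {I J : Finset V}
    (h : InternallySolved puz G σ I) (hI : 2 ≤ I.card) {v : V}
    (hv : v ∈ (I \ J) \ outerBoundary puz J (I \ J)) :
    (∃ u ∈ I \ J, G.Adj v u) ∨ σ ≤ degIn G v J := by
  obtain ⟨hvT, hvD⟩ := Finset.mem_sdiff.1 hv
  by_cases hex : ∃ u ∈ I \ J, G.Adj v u
  · exact Or.inl hex
  right
  push Not at hex
  rcases h.good hσ hI (Finset.mem_sdiff.1 hvT).1 with ⟨u, hu, h1, h2⟩ | h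
  · by_cases huJ : u ∈ J
    · exact absurd (mem_outerBoundary.2 ⟨hvT, u, huJ, h1⟩) hvD
    · exact absurd h2 (hex u (Finset.mem_sdiff.2 ⟨hu, huJ⟩))
  · classical
    refine h.trans (Finset.card_le_card fun w hw => ?_)
    obtain ⟨hw1, hw2⟩ := Finset.mem_filter.1 hw
    refine Finset.mem_filter.2 ⟨?_, hw2⟩
    by_contra hwJ
    exact hex w (Finset.mem_sdiff.2 ⟨hw1, hwJ⟩) hw2

end Arcs

/-! ### A bound through the history of an internally solved set -/

section Antitone

variable {f : ℕ → ℝ}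

theorem sum_range_add_le_mul (hf : Antitone f) (j t : ℕ) :
    ∑ i ∈ Finset.range (j + t), f i ≤ ∑ i ∈ Finset.range j, f i + t * f j := by
  rw [Finset.sum_range_add]
  gcongr
  have : ∀ i ∈ Finset.range t, f (j + i) ≤ f j := fun i _ => hf (by omega)
  simpa using Finset.sum_le_sum this

theorem sum_range_add_le_add (hf : Antitone f) (a b : ℕ) :
    ∑ i ∈ Finset.range (a + b), f i ≤ ∑ i ∈ Finset.range a, f i + ∑ i ∈ Finset.range b, f i := by
  rw [Finset.sum_range_add]
  gcongr with i
  exact hf (by omega)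

end Antitone

section UpperBound

/-- The Poisson mean for which a vertex is positive with probability `p`. -/
def edgeMean (p : ℝ) : ℝ := -Real.log (1 - p)

/-- The truncated cost of adding a vertex to a set of size `i`. -/
def growthCost (c : ℝ) (σ : ℕ) (p : ℝ) (i : ℕ) : ℝ := truncRate c σ (edgeMean p * i)

theorem edgeMean_pos {p : ℝ} (h0 : 0 < p) (h1 : p < 1) : 0 < edgeMean p := by
  have := Real.log_neg (x := 1 - p) (by linarith) (by linarith)
  rw [edgeMean]; linarith

theorem growthCost_antitone (c : ℝ) (σ : ℕ) {p : ℝ} (h0 : 0 < p) (h1 : p < 1) :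
    Antitone (growthCost c σ p) := by
  intro i j h
  have := edgeMean_pos h0 h1
  exact truncRate_antitone c σ (by gcongr)

theorem binomTail_le_exp_growthCost (c : ℝ) (σ : ℕ) {p : ℝ} (h0 : 0 < p) (h1 : p < 1) (k : ℕ) :
    binomTail p k σ ≤ Real.exp (-growthCost c σ p k) := by
  have hs := edgeMean_pos h0 h1
  rw [growthCost, exp_neg_truncRate]
  refine le_max_of_le_right ?_
  have h := binomTail_le_poissonTail (edgeMean p).toNNReal k σ
  rw [Real.coe_toNNReal _ hs.le] at h
  have e : 1 - Real.exp (-edgeMean p) = p := by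
    rw [edgeMean, neg_neg, Real.exp_log (by linarith)]; ring
  rw [e] at h
  rwa [mul_comm, Real.toNNReal_mul (by positivity), Real.toNNReal_natCast]

variable {V : Type*} [DecidableEq V] [Fintype V] {p : unitInterval} {puz : SimpleGraph V}
  {s : Equiv.Perm V} {σ : ℕ} {c : ℝ}

theorem one_add_pow_le_exp {x : ℝ} (hx : 0 ≤ x) (k : ℕ) : (1 + x) ^ k ≤ Real.exp (x * k) := by
  rw [mul_comm, Real.exp_nat_mul]
  exact pow_le_pow_left₀ (by linarith) (by linarith [Real.add_one_le_exp x]) k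

/-- The cost of filling up the arc `J` to an internally solved set `I`. -/
theorem binomialRandom_real_inter_internallySolved_le (hσ : 1 ≤ σ) (hc : 0 ≤ c)
    (h0 : 0 < (p : ℝ)) (h1 : (p : ℝ) < 1)
    (hs : ∀ u v, puz.Adj u v → v = s u ∨ u = s v) {I J : Finset V} (hJI : J ⊆ I)
    (hI : 2 ≤ I.card) (hJ : ∃ a k, J = arc s a k) {A : Set (SimpleGraph V)}
    (hA : DependsOnEdges J.sym2 A) :
    (SimpleGraph.binomialRandom V p).real (A ∩ {G | InternallySolved puz G σ I}) ≤
      (SimpleGraph.binomialRandom V p).real A *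
        Real.exp (-(∑ i ∈ Finset.range I.card, growthCost c σ p i -
            ∑ i ∈ Finset.range J.card, growthCost c σ p i) + 2 * c +
          p * Real.exp (2 * c) * (I \ J).card ^ 2) := by
  set f := growthCost c σ p with hf
  set T := I \ J with hT
  have hJT : Disjoint J T := Finset.disjoint_sdiff
  set D := outerBoundary puz J T
  have hD : D.card ≤ 2 := card_outerBoundary_le hs hJT hJ
  have hf0 : 0 ≤ f J.card := truncRate_nonneg hc _ _
  have hfc : f J.card ≤ c := truncRate_le _ _ _
  have hcard : I.card = J.card + T.card := by
    rw [hT, Finset.card_sdiff_of_subset hJI]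
    have := Finset.card_le_card hJI
    omega
  have main := binomialRandom_real_inter_good_le (D := D) hJT hA (Real.exp_pos (-f J.card))
    (Real.exp_le_one_iff.2 (by linarith)) (binomTail_le_exp_growthCost c σ h0 h1 J.card)
  refine (measureReal_mono ?_ (measure_ne_top _ _)).trans (main.trans ?_)
  · exact fun G hG => ⟨hG.1, fun v hv => hG.2.good_sdiff hσ hI hv⟩
  refine mul_le_mul_of_nonneg_left ?_ measureReal_nonneg
  -- with `q = exp (-f #J) ≥ exp (-c)`, the three factors of the bound
  have e1 : Real.exp (-f J.card) ^ T.card = Real.exp (-(T.card * f J.card)) := by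
    rw [← Real.exp_nat_mul]; ring_nf
  have e2 : (Real.exp (-f J.card) ^ D.card)⁻¹ ≤ Real.exp (2 * c) := by
    rw [← Real.exp_nat_mul, ← Real.exp_neg]
    refine Real.exp_le_exp.2 ?_
    have : (D.card : ℝ) ≤ 2 := by exact_mod_cast hD
    nlinarith
  have e3 : (1 + (p : ℝ) / Real.exp (-f J.card) ^ 2) ^ (T.card ^ 2) ≤
      Real.exp (p * Real.exp (2 * c) * T.card ^ 2) := by
    have : (p : ℝ) / Real.exp (-f J.card) ^ 2 ≤ p * Real.exp (2 * c) := by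
      rw [div_eq_mul_inv, ← Real.exp_nat_mul, ← Real.exp_neg]
      gcongr
      push_cast
      linarith
    refine le_trans (pow_le_pow_left₀ (by positivity) (add_le_add_right this 1) _) ?_
    have := one_add_pow_le_exp (x := p * Real.exp (2 * c)) (by positivity) (T.card ^ 2)
    rwa [Nat.cast_pow] at this
  have hΨ := sum_range_add_le_mul (growthCost_antitone c σ h0 h1) J.card T.card
  rw [← hf, ← hcard] at hΨ
  rw [Real.exp_add, Real.exp_add, div_eq_mul_inv, e1]
  gcongr
  linarith

/-- The cost of an internally solved set which is so small that its vertices can hardly all have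
a neighbour in it. -/
theorem binomialRandom_real_internallySolved_le_of_small (hσ : 1 ≤ σ) (hc : 0 ≤ c) {I : Finset V}
    (hI : 2 ≤ I.card) (hIc : (p : ℝ) * I.card * Real.exp (4 * c) ≤ c) :
    (SimpleGraph.binomialRandom V p).real {G | InternallySolved puz G σ I} ≤
      Real.exp (-(c * I.card)) := by
  have h0 : (0 : ℝ) ≤ p := p.2.1
  have hb : binomTail p (∅ : Finset V).card σ ≤ Real.exp (-(2 * c)) := by
    obtain ⟨k, rfl⟩ : ∃ k, σ = k + 1 := ⟨σ - 1, by omega⟩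
    simpa using (Real.exp_pos _).le
  have main := binomialRandom_real_inter_good_le (D := ∅) (J := ∅) (T := I) (A := univ)
    (Finset.disjoint_empty_left I) (fun _ _ _ _ => trivial) (Real.exp_pos (-(2 * c)))
    (Real.exp_le_one_iff.2 (by linarith)) hb
  refine (measureReal_mono ?_ (measure_ne_top _ _)).trans (main.trans ?_)
  · refine fun G hG => ⟨trivial, fun v hv => ?_⟩
    have := InternallySolved.good_sdiff (J := ∅) hσ hG hI (v := v) (by
      simpa [mem_outerBoundary] using hv)
    simpa using this
  rw [probReal_univ, one_mul, Finset.card_empty, pow_zero, div_one, ← Real.exp_nat_mul]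
  have := one_add_pow_le_exp (x := (p : ℝ) / Real.exp (-(2 * c)) ^ 2) (by positivity) (I.card ^ 2)
  refine (mul_le_mul_of_nonneg_left this (Real.exp_pos _).le).trans ?_
  rw [← Real.exp_add, div_eq_mul_inv, ← Real.exp_nat_mul, ← Real.exp_neg]
  refine Real.exp_le_exp.2 ?_
  rw [show -(((2 : ℕ) : ℝ) * -(2 * c)) = 4 * c by push_cast; ring]
  push_cast
  have hn : (0 : ℝ) ≤ I.card := by positivity
  nlinarith

/-- The bound on the probability that a set of size at least `d` is internally solved. The size `d`
is the scale at which its history is observed: the total cost `κ * #I` of the errors comes from the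
choice of the subsets in the history (`A`) and from the edges among the vertices added between two
observations (`β`). -/
theorem binomialRandom_real_internallySolved_le (hσ : 1 ≤ σ) (hc : 0 ≤ c)
    (h0 : 0 < (p : ℝ)) (h1 : (p : ℝ) < 1) (hs : ∀ u v, puz.Adj u v → v = s u ∨ u = s v)
    {d k₁ N : ℕ} (hd : 2 ≤ d) (hdk : 3 * d + 1 ≤ k₁) (hpk : (p : ℝ) * k₁ * Real.exp (4 * c) ≤ c)
    {A β κ : ℝ} (hA : A = 2 * c + 4 * Real.log (N + 1)) (hβ : β = 2 * p * d * Real.exp (2 * c))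
    (hκ : κ = A / d + β) (I : Finset V) (hdI : d ≤ I.card) (hIN : I.card ≤ N) :
    (SimpleGraph.binomialRandom V p).real {G | InternallySolved puz G σ I} ≤
      Real.exp (-∑ i ∈ Finset.range I.card, growthCost c σ p i + κ * I.card - A) := by
  classical
  have hA0 : 0 ≤ A := by
    have : 0 ≤ Real.log (N + 1) := Real.log_nonneg (by linarith [(Nat.cast_nonneg N : (0:ℝ) ≤ N)])
    linarith
  have hβ0 : 0 ≤ β := by rw [hβ]; positivity
  have hd0 : (0 : ℝ) < d := by positivity
  have hκβ : β ≤ κ := by rw [hκ]; linarith [div_nonneg hA0 hd0.le]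
  have hκd : ∀ t : ℕ, d ≤ t → A + β * t ≤ κ * t := by
    intro t ht
    have ht' : (d : ℝ) ≤ t := by exact_mod_cast ht
    rw [hκ, add_mul]
    gcongr
    rw [div_mul_eq_mul_div, le_div_iff₀ hd0]
    gcongr
  have hβt : ∀ t : ℕ, t ≤ 2 * d → p * Real.exp (2 * c) * (t : ℝ) ^ 2 ≤ β * t := by
    intro t ht
    have ht' : (t : ℝ) ≤ 2 * d := by exact_mod_cast ht
    have hh : (p * Real.exp (2 * c) * t) * t ≤ (p * Real.exp (2 * c) * t) * (2 * d) := by gcongr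
    rw [hβ]; nlinarith
  set Ψ : ℕ → ℝ := fun k => ∑ i ∈ Finset.range k, growthCost c σ p i with hΨ
  have hsub : ∀ a b, Ψ (a + b) ≤ Ψ a + Ψ b := fun a b =>
    sum_range_add_le_add (growthCost_antitone c σ h0 h1) a b
  set μ := SimpleGraph.binomialRandom V p
  change μ.real {G | InternallySolved puz G σ I} ≤ Real.exp (-Ψ I.card + κ * I.card - A)
  induction hk : I.card using Nat.strong_induction_on generalizing I with
  | _ k ih =>
  rw [hk] at hdI hIN
  have IH : ∀ J : Finset V, J.card < k → d ≤ J.card →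
      μ.real {G | InternallySolved puz G σ J} ≤ Real.exp (-Ψ J.card + κ * J.card - A) :=
    fun J hJ hdJ => ih J.card hJ J hdJ (by omega) rfl
  by_cases hkk : k ≤ k₁
  · have hkk' : (k : ℝ) ≤ k₁ := by exact_mod_cast hkk
    refine (binomialRandom_real_internallySolved_le_of_small hσ hc (by omega) ?_).trans ?_
    · rw [hk]
      refine le_trans ?_ hpk
      gcongr
    · rw [hk]
      refine Real.exp_le_exp.2 ?_
      have h2 : Ψ k ≤ k * c := by
        have : ∀ i ∈ Finset.range k, growthCost c σ p i ≤ c := fun i _ => truncRate_le _ _ _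
        simpa using Finset.sum_le_sum this
      have := hκd k hdI
      nlinarith [mul_nonneg hβ0 (Nat.cast_nonneg k : (0:ℝ) ≤ k)]
  push Not at hkk
  -- the two kinds of history: one large subset (`S₁`), or two merging ones (`S₂`)
  have hI2 : 2 ≤ I.card := by omega
  set S := subarcs s I
  let S₁ := S.filter fun J => J ⊆ I ∧ J.card + d ≤ k ∧ k ≤ J.card + 2 * d ∧ ∃ a l, J = arc s a l
  let S₂ := (S ×ˢ S).filter fun x => Disjoint x.1 x.2 ∧ x.1 ⊆ I ∧ x.2 ⊆ I ∧ d ≤ x.1.card ∧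
    d ≤ x.2.card ∧ k < x.1.card + x.2.card + d ∧ ∃ a l, x.1 ∪ x.2 = arc s a l
  let E : Finset V → Set (SimpleGraph V) := fun J => {G | InternallySolved puz G σ J}
  have hcover : E I ⊆ (⋃ J ∈ S₁, E J ∩ E I) ∪ ⋃ x ∈ S₂, (E x.1 ∩ E x.2) ∩ E I := by
    intro G hG
    have hG' : InternallySolved puz G σ I := hG
    rcases hG'.exists_history (d := d) (by omega) with ⟨J, hJI, hJ, h2, h3⟩ |
      ⟨J₁, J₂, hJ₁I, hJ₂I, hdis, hJ₁, hJ₂, hJ, h2, h3, h4⟩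
    · left
      simp only [mem_iUnion]
      obtain ⟨a, -, ha⟩ := hJ.exists_eq_arc hs
      exact ⟨J, Finset.mem_filter.2 ⟨hJ.mem_subarcs hs hJI, hJI, by omega, by omega, a, _, ha⟩,
        hJ, hG⟩
    · right
      simp only [mem_iUnion]
      obtain ⟨a, -, ha⟩ := hJ.exists_eq_arc hs
      exact ⟨(J₁, J₂), Finset.mem_filter.2 ⟨Finset.mem_product.2
        ⟨hJ₁.mem_subarcs hs hJ₁I, hJ₂.mem_subarcs hs hJ₂I⟩, hdis, hJ₁I, hJ₂I, h2, h3,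
          by rwa [hk] at h4, a, _, ha⟩, ⟨hJ₁, hJ₂⟩, hG⟩
  -- the common bound for each history; there are at most `exp (A - 2 * c)` of them
  set b := Real.exp (-Ψ k + κ * k - 2 * A + 2 * c) with hb
  have hb₁ : ∀ J ∈ S₁, μ.real (E J ∩ E I) ≤ b := by
    intro J hJ
    obtain ⟨-, hJI, h2, h3, hJa⟩ := Finset.mem_filter.1 hJ
    have ht : (I \ J).card + J.card = k := by rw [Finset.card_sdiff_add_card_eq_card hJI, hk]
    have ht' : ((I \ J).card : ℝ) + J.card = k := by exact_mod_cast ht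
    refine (binomialRandom_real_inter_internallySolved_le hσ hc h0 h1 hs hJI hI2 hJa
      (dependsOnEdges_internallySolved puz σ J)).trans ?_
    refine (mul_le_mul_of_nonneg_right (IH J (by omega) (by omega)) (Real.exp_pos _).le).trans ?_
    rw [← Real.exp_add, hb, hk]
    refine Real.exp_le_exp.2 ?_
    have e1 := hβt (I \ J).card (by omega)
    have e2 := hκd (I \ J).card (by omega)
    change _ + (-(Ψ k - Ψ J.card) + _ + _) ≤ _
    rw [← ht']
    linarith
  have hb₂ : ∀ x ∈ S₂, μ.real ((E x.1 ∩ E x.2) ∩ E I) ≤ b := by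
    rintro ⟨J₁, J₂⟩ hJ
    obtain ⟨-, hdis, hJ₁I, hJ₂I, h2, h3, h4, hJa⟩ := Finset.mem_filter.1 hJ
    dsimp only at hdis hJ₁I hJ₂I h2 h3 h4 hJa ⊢
    have hJI := Finset.union_subset hJ₁I hJ₂I
    have hJc := Finset.card_union_of_disjoint hdis
    have ht : (I \ (J₁ ∪ J₂)).card + (J₁.card + J₂.card) = k := by
      rw [← hJc, Finset.card_sdiff_add_card_eq_card hJI, hk]
    have ht' : ((I \ (J₁ ∪ J₂)).card : ℝ) + (J₁.card + J₂.card) = k := by exact_mod_cast ht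
    have hdep₁ := dependsOnEdges_internallySolved puz σ J₁
    have hdep₂ := dependsOnEdges_internallySolved puz σ J₂
    have hprod : μ.real (E J₁ ∩ E J₂) ≤ Real.exp (-Ψ J₁.card + κ * J₁.card - A) *
        Real.exp (-Ψ J₂.card + κ * J₂.card - A) := by
      rw [binomialRandom_real_inter hdep₁ hdep₂ (disjoint_sym2 hdis)]
      exact mul_le_mul (IH J₁ (by omega) h2) (IH J₂ (by omega) h3) measureReal_nonneg
        (Real.exp_pos _).le
    refine (binomialRandom_real_inter_internallySolved_le hσ hc h0 h1 hs hJI hI2 hJa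
      ((hdep₁.mono (Finset.sym2_mono Finset.subset_union_left)).inter
        (hdep₂.mono (Finset.sym2_mono Finset.subset_union_right)))).trans ?_
    refine (mul_le_mul_of_nonneg_right hprod (Real.exp_pos _).le).trans ?_
    rw [← Real.exp_add, ← Real.exp_add, hb, hk]
    refine Real.exp_le_exp.2 ?_
    have e1 := hβt (I \ (J₁ ∪ J₂)).card (by omega)
    have e2 : β * (I \ (J₁ ∪ J₂)).card ≤ κ * (I \ (J₁ ∪ J₂)).card := by gcongr
    have e3 := hsub J₁.card J₂.card
    change _ + (-(Ψ k - Ψ (J₁ ∪ J₂).card) + _ + _) ≤ _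
    rw [hJc, ← ht']
    linarith
  have hcount : ((S₁.card + S₂.card : ℕ) : ℝ) ≤ Real.exp (4 * Real.log (N + 1)) := by
    have hS : S.card ≤ N * (N + 1) :=
      (card_subarcs_le s I).trans (Nat.mul_le_mul (by omega) (by omega))
    have hS₁ : S₁.card ≤ S.card := Finset.card_filter_le _ _
    have hS₂ : S₂.card ≤ S.card * S.card :=
      (Finset.card_filter_le _ _).trans (by rw [Finset.card_product])
    have h4 : S₁.card + S₂.card ≤ (N + 1) ^ 4 := by
      have : S.card * S.card ≤ (N * (N + 1)) * (N * (N + 1)) := Nat.mul_le_mul hS hS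
      nlinarith
    have h5 : Real.exp (4 * Real.log (N + 1)) = ((N : ℝ) + 1) ^ 4 := by
      have : (0:ℝ) < N + 1 := by positivity
      rw [show (4:ℝ) = ((4:ℕ):ℝ) by norm_num, Real.exp_nat_mul, Real.exp_log this]
    rw [h5]
    exact_mod_cast h4
  calc μ.real (E I) ≤ μ.real ((⋃ J ∈ S₁, E J ∩ E I) ∪ ⋃ x ∈ S₂, (E x.1 ∩ E x.2) ∩ E I) :=
        measureReal_mono hcover (measure_ne_top _ _)
    _ ≤ ∑ J ∈ S₁, μ.real (E J ∩ E I) + ∑ x ∈ S₂, μ.real ((E x.1 ∩ E x.2) ∩ E I) :=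
        (measureReal_union_le _ _).trans
          (add_le_add (measureReal_biUnion_finset_le _ _) (measureReal_biUnion_finset_le _ _))
    _ ≤ S₁.card * b + S₂.card * b := by
        refine add_le_add ?_ ?_
        · simpa using Finset.sum_le_sum hb₁
        · simpa using Finset.sum_le_sum hb₂
    _ = ((S₁.card + S₂.card : ℕ) : ℝ) * b := by push_cast; ring
    _ ≤ Real.exp (4 * Real.log (N + 1)) * b :=
        mul_le_mul_of_nonneg_right hcount (Real.exp_pos _).le
    _ = _ := by
        rw [hb, ← Real.exp_add]
        congr 1
        linarith

end UpperBound

/-! ### Internally solved sets of the critical size -/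

theorem edgeMean_le {p : ℝ} (h1 : p < 1) : (1 - p) * edgeMean p ≤ p := by
  have h := Real.one_sub_inv_le_log_of_pos (x := 1 - p) (by linarith)
  have h2 : (1 - p) * (1 - p)⁻¹ = 1 := mul_inv_cancel₀ (by linarith)
  rw [edgeMean]
  nlinarith

theorem le_edgeMean {p : ℝ} (h1 : p < 1) : p ≤ edgeMean p := by
  have h := Real.log_le_sub_one_of_pos (x := 1 - p) (by linarith)
  rw [edgeMean]
  linarith

/-- For small `p` and sets of size between `K` and `2 * K`, with `K` a large multiple of `1 / p`,
the probability of being internally solved is at most `exp (-(λ_σ - o(1)) / p)`. -/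
theorem eventually_internallySolved_le {σ : ℕ} (hσ : 1 ≤ σ) {η : ℝ} (hη : 0 < η) :
    ∃ C : ℝ, 0 < C ∧ ∀ᶠ x : ℝ in 𝓝[>] 0, ∃ K : ℕ, 1 ≤ K ∧ (K : ℝ) ≤ C / x ∧
      ∀ p : unitInterval, (p : ℝ) = x → ∀ (V : Type) [DecidableEq V] [Fintype V]
        (puz : SimpleGraph V) (s : Equiv.Perm V), (∀ u v, puz.Adj u v → v = s u ∨ u = s v) →
        ∀ I : Finset V, K ≤ I.card → I.card < 2 * K →
        (SimpleGraph.binomialRandom V p).real {G | InternallySolved puz G σ I} ≤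
          Real.exp (-(ringConst σ - η) / x) := by
  obtain ⟨m, hm0, hm⟩ := exists_truncRate_integral hσ (η := η / 4) (by linarith)
  set J := ∫ x in (0:ℝ)..m, truncRate m σ x
  set c : ℝ := (m : ℝ) with hc
  have hc0 : 0 < c := by rw [hc]; exact_mod_cast hm0
  -- The bound for small sets applies up to the size `w / p`. The scale `d ≈ δ / p` is such that
  -- `3 * d + 1` does not exceed this size and that the errors counted by `β` stay below `η / 4`.
  set w : ℝ := c * Real.exp (-(4 * c)) with hw
  have hw0 : 0 < w := by positivity
  have hwc : w ≤ c := by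
    have : Real.exp (-(4 * c)) ≤ 1 := Real.exp_le_one_iff.2 (by linarith)
    rw [hw]; nlinarith
  set δ : ℝ := min (η / (32 * Real.exp (2 * c) * (c + 1))) (w / 6) with hδ
  have hδ0 : 0 < δ := by positivity
  have hδ1 : δ * (32 * Real.exp (2 * c) * (c + 1)) ≤ η := by
    rw [← le_div_iff₀ (by positivity)]; exact min_le_left _ _
  have hδ2 : 6 * δ ≤ w := by linarith [min_le_right (η / (32 * Real.exp (2 * c) * (c + 1))) (w / 6)]
  have hlim : Tendsto (fun x : ℝ => (2 * (c + 1) / δ) *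
      (x * (2 * c + 4 * Real.log (2 * c + 3)) - 4 * (x * Real.log x))) (𝓝[>] 0) (𝓝 0) := by
    have h1 : ContinuousAt (fun x : ℝ => (2 * (c + 1) / δ) *
      (x * (2 * c + 4 * Real.log (2 * c + 3)) - 4 * (x * Real.log x))) 0 := by
      have := Real.continuous_mul_log.continuousAt (x := 0)
      fun_prop
    have := h1.tendsto
    simp only [zero_mul, Real.log_zero, mul_zero, sub_zero] at this
    exact this.mono_left nhdsWithin_le_nhds
  have hlim' := (tendsto_order.1 hlim).2 (η / 4) (by linarith)
  have hlimJ : Tendsto (fun x : ℝ => x * J) (𝓝[>] 0) (𝓝 0) := by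
    have : ContinuousAt (fun x : ℝ => x * J) 0 := by fun_prop
    have := this.tendsto
    simp only [zero_mul] at this
    exact this.mono_left nhdsWithin_le_nhds
  have hlimJ' := (tendsto_order.1 hlimJ).2 (η / 4) (by linarith)
  refine ⟨c + 1, by linarith, ?_⟩
  filter_upwards [hlim', hlimJ', self_mem_nhdsWithin, Ioo_mem_nhdsGT one_pos, Ioo_mem_nhdsGT hδ0,
    Ioo_mem_nhdsGT (show 0 < w / 10 by positivity)] with x hx1 hx2 hx0 hx3 hx4 hx5
  replace hx0 : 0 < x := hx0
  replace hx3 := hx3.2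
  replace hx4 := hx4.2
  replace hx5 := hx5.2
  have hcx : 0 < c / x := by positivity
  have hK1 : c / x ≤ ⌈c / x⌉₊ := Nat.le_ceil _
  have hK2 := (Nat.ceil_lt_add_one hcx.le).le
  set K := ⌈c / x⌉₊
  have hKx1 : c ≤ x * K := by rw [div_le_iff₀ hx0] at hK1; linarith
  have hKx2 : x * K ≤ c + x := by
    have := mul_le_mul_of_nonneg_left hK2 hx0.le
    rw [mul_add, mul_div_cancel₀ _ hx0.ne'] at this; linarith
  refine ⟨K, Nat.one_le_iff_ne_zero.2 (Nat.ceil_pos.2 hcx).ne', ?_, ?_⟩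
  · rw [le_div_iff₀ hx0]; linarith
  rintro p rfl V _ _ puz s hs I hI1 hI2
  have hd1 : δ / p ≤ ⌈δ / p⌉₊ := Nat.le_ceil _
  have hd2 := (Nat.ceil_lt_add_one (show 0 ≤ δ / p by positivity)).le
  have hd3 : 1 < ⌈δ / p⌉₊ := by
    rw [Nat.lt_ceil, Nat.cast_one, one_lt_div hx0]; exact hx4
  have hdK : ⌈δ / p⌉₊ ≤ K := by
    refine Nat.ceil_le_ceil ?_
    gcongr
    linarith
  set d := ⌈δ / p⌉₊
  have hpd1 : δ ≤ (p : ℝ) * d := by rw [div_le_iff₀ hx0] at hd1; linarith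
  have hpd2 : (p : ℝ) * d ≤ 2 * δ := by
    have := mul_le_mul_of_nonneg_left hd2 hx0.le
    rw [mul_add, mul_div_cancel₀ _ hx0.ne'] at this; linarith
  have hk1 : ((⌊w / p⌋₊ : ℕ) : ℝ) ≤ w / p := Nat.floor_le (by positivity)
  have hk2 : 3 * d + 1 ≤ ⌊w / p⌋₊ := by
    refine Nat.le_floor ?_
    rw [le_div_iff₀ hx0]
    push_cast
    have := mul_le_mul_of_nonneg_right hd2 hx0.le
    rw [add_mul, div_mul_cancel₀ _ hx0.ne'] at this
    nlinarith
  set k₁ := ⌊w / p⌋₊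
  have hpk : (p : ℝ) * k₁ * Real.exp (4 * c) ≤ c := by
    have h1 : (p : ℝ) * k₁ ≤ w := by rw [le_div_iff₀ hx0] at hk1; linarith
    calc (p : ℝ) * k₁ * Real.exp (4 * c) ≤ w * Real.exp (4 * c) := by gcongr
      _ = c := by rw [hw, mul_assoc, ← Real.exp_add]; simp
  have main := binomialRandom_real_internallySolved_le (puz := puz) hσ hc0.le hx0 hx3 hs
    (N := 2 * K) hd3 hk2 hpk rfl rfl rfl I (hdK.trans hI1) hI2.le
  refine main.trans (Real.exp_le_exp.2 ?_)
  clear main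
  rw [le_div_iff₀ hx0]
  have hs0 := edgeMean_pos hx0 hx3
  have hIK1 : (K : ℝ) ≤ I.card := by exact_mod_cast hI1
  have hIK2 : (I.card : ℝ) ≤ 2 * K := by exact_mod_cast hI2.le
  -- the main term
  have hΨ : J - η / 4 ≤ p * ∑ i ∈ Finset.range I.card, growthCost c σ p i := by
    have h1 := integral_truncRate_le_sum hc0.le σ hs0 hc0.le (k := I.card) (by
      calc c ≤ p * K := hKx1
        _ ≤ edgeMean p * I.card := by
          gcongr
          exact le_edgeMean hx3)
    change J ≤ edgeMean p * ∑ i ∈ Finset.range I.card, growthCost c σ p i at h1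
    have hS : 0 ≤ ∑ i ∈ Finset.range I.card, growthCost c σ p i :=
      Finset.sum_nonneg fun i _ => truncRate_nonneg hc0.le _ _
    have h2 := mul_le_mul_of_nonneg_left h1 (show (0:ℝ) ≤ 1 - p by linarith)
    have h3 := mul_le_mul_of_nonneg_right (edgeMean_le hx3) hS
    nlinarith
  -- the errors
  have hA : 2 * c + 4 * Real.log (((2 * K : ℕ) : ℝ) + 1) ≤
      2 * c + 4 * (Real.log (2 * c + 3) - Real.log p) := by
    rw [← Real.log_div (by positivity) hx0.ne']
    gcongr
    rw [le_div_iff₀ hx0]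
    push_cast
    have : (2 * (K : ℝ) + 1) * p = 2 * (p * K) + p := by ring
    linarith
  have hlogN : 0 ≤ Real.log (((2 * K : ℕ) : ℝ) + 1) :=
    Real.log_nonneg (by linarith [(Nat.cast_nonneg (2 * K) : (0:ℝ) ≤ ((2 * K : ℕ) : ℝ))])
  set A : ℝ := 2 * c + 4 * Real.log (((2 * K : ℕ) : ℝ) + 1)
  have hA0 : 0 ≤ A := by simp only [A]; linarith
  have hd0 : (0:ℝ) < d := by positivity
  have hpI : p * (I.card : ℝ) ≤ 2 * (c + 1) := by
    have := mul_le_mul_of_nonneg_left hIK2 hx0.le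
    linarith
  have herr1 : p * (A / d * I.card) ≤ η / 4 := by
    refine le_trans ?_ hx1.le
    have h1 : (I.card : ℝ) / d ≤ 2 * (c + 1) / δ := by
      rw [div_le_div_iff₀ hd0 hδ0]
      calc (I.card : ℝ) * δ ≤ I.card * (p * d) := by gcongr
        _ = (p * I.card) * d := by ring
        _ ≤ 2 * (c + 1) * d := by gcongr
    calc p * (A / d * I.card) = (I.card / d) * (p * A) := by ring
      _ ≤ (2 * (c + 1) / δ) * (p * (2 * c + 4 * (Real.log (2 * c + 3) - Real.log p))) := by
        gcongr
      _ = _ := by ring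
  have herr2 : (p : ℝ) * (2 * p * d * Real.exp (2 * c) * I.card) ≤ η / 4 := by
    calc (p : ℝ) * (2 * p * d * Real.exp (2 * c) * I.card)
        = 2 * ((p : ℝ) * d) * Real.exp (2 * c) * (p * I.card) := by ring
      _ ≤ 2 * (2 * δ) * Real.exp (2 * c) * (2 * (c + 1)) := by gcongr
      _ ≤ η / 4 := by linarith
  have e : ∀ S a b n q : ℝ, (-S + (a + b) * n - A) * q =
      -(q * S) + q * (a * n) + q * (b * n) - q * A := by
    intros; ring
  rw [e]
  linarith [mul_nonneg hx0.le hA0]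

/-! ### Solving the ring requires a nucleus -/

theorem cycleGraph_adj_addRight {n : ℕ} (u v : Fin (n + 2))
    (h : (SimpleGraph.cycleGraph (n + 2)).Adj u v) :
    v = Equiv.addRight (1 : Fin (n + 2)) u ∨ u = Equiv.addRight (1 : Fin (n + 2)) v := by
  rw [SimpleGraph.cycleGraph_adj] at h
  rcases h with h | h
  · right; simp [← h]
  · left; simp [← h]

/-- Solving the ring requires an internally solved arc of size between `K` and `2 * K`. -/
theorem ringSolveProb_le {σ n : ℕ} (hn : 2 ≤ n) {p : unitInterval} {K : ℕ} (hK : 1 ≤ K)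
    (hKn : K ≤ n) {b : ℝ} (hb0 : 0 ≤ b)
    (hb : ∀ s : Equiv.Perm (Fin n),
      (∀ u v, (SimpleGraph.cycleGraph n).Adj u v → v = s u ∨ u = s v) →
      ∀ I : Finset (Fin n), K ≤ I.card → I.card < 2 * K →
      (SimpleGraph.binomialRandom (Fin n) p).real
        {G | InternallySolved (SimpleGraph.cycleGraph n) G σ I} ≤ b) :
    ringSolveProb σ n p ≤ n * (2 * K) * b := by
  obtain ⟨n, rfl⟩ : ∃ k, n = k + 2 := ⟨n - 2, by omega⟩
  set s := Equiv.addRight (1 : Fin (n + 2))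
  set puz := SimpleGraph.cycleGraph (n + 2)
  have hs : ∀ u v, puz.Adj u v → v = s u ∨ u = s v := cycleGraph_adj_addRight
  let S : Finset (Finset (Fin (n + 2))) := ((Finset.univ ×ˢ Finset.range (2 * K)).image
    fun x => arc s x.1 x.2).filter fun I => K ≤ I.card ∧ I.card < 2 * K
  have hS : S.card ≤ (n + 2) * (2 * K) := by
    refine (Finset.card_filter_le _ _).trans (Finset.card_image_le.trans ?_)
    simp
  have hsub : {G | Solves puz G σ 1 ⊤} ⊆ ⋃ I ∈ S, {G | InternallySolved puz G σ I} := by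
    intro G hG
    obtain ⟨I, -, hI, h1, h2⟩ := (solves_iff.1 hG).exists_card_mem_Ico hK (by simpa using hKn)
    simp only [mem_iUnion]
    obtain ⟨a, -, ha⟩ := hI.exists_eq_arc hs
    refine ⟨I, Finset.mem_filter.2 ⟨Finset.mem_image.2 ⟨(a, I.card), ?_, ha.symm⟩, h1, h2⟩, hI⟩
    simpa using h2
  calc ringSolveProb σ (n + 2) p
      ≤ ∑ I ∈ S, (SimpleGraph.binomialRandom (Fin (n + 2)) p).real
          {G | InternallySolved puz G σ I} :=
        (measureReal_mono hsub (measure_ne_top _ _)).trans (measureReal_biUnion_finset_le _ _)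
    _ ≤ S.card * b := by
        have : ∀ I ∈ S, (SimpleGraph.binomialRandom (Fin (n + 2)) p).real
          {G | InternallySolved puz G σ I} ≤ b := fun I hI =>
            hb s hs I (Finset.mem_filter.1 hI).2.1 (Finset.mem_filter.1 hI).2.2
        simpa using Finset.sum_le_sum this
    _ ≤ _ := by
        gcongr
        exact_mod_cast hS

/-! ### Growth from disjoint intervals -/

section Growth

variable {n : ℕ}

/-- The vertices `a, …, b - 1` of the ring. -/
def seg (n a b : ℕ) : Finset (Fin n) := Finset.univ.filter fun v => a ≤ v.val ∧ v.val < b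

theorem mem_seg {a b : ℕ} {v : Fin n} : v ∈ seg n a b ↔ a ≤ v.val ∧ v.val < b := by
  simp [seg]

theorem map_seg {a b : ℕ} (hb : b ≤ n) : (seg n a b).map Fin.valEmbedding = Finset.Ico a b := by
  ext i
  simp only [Finset.mem_map, mem_seg, Fin.valEmbedding_apply, Finset.mem_Ico]
  exact ⟨by rintro ⟨v, hv, rfl⟩; exact hv, fun h => ⟨⟨i, by omega⟩, h, rfl⟩⟩

theorem card_seg {a b : ℕ} (hb : b ≤ n) : (seg n a b).card = b - a := by
  rw [← Finset.card_map Fin.valEmbedding, map_seg hb, Nat.card_Ico]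

theorem disjoint_seg {a b a' b' : ℕ} (h : b ≤ a') : Disjoint (seg n a b) (seg n a' b') := by
  rw [Finset.disjoint_left]
  intro v hv hv'
  rw [mem_seg] at hv hv'
  omega

/-- The vertex `v` can be added to the interval `[a, v)`. -/
def growsAt (σ a : ℕ) (v : Fin n) : Set (SimpleGraph (Fin n)) :=
  {G | (∃ u ∈ seg n a v, u.val + 1 = v ∧ G.Adj v u) ∨ σ ≤ degIn G v (seg n a v)}

/-- The interval `[a, a + L)` is internally solved by adding its vertices from left to right. -/
def grows (σ a L : ℕ) : Set (SimpleGraph (Fin n)) :=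
  ⋂ v ∈ seg n (a + 1) (a + L), growsAt σ a v

theorem notMem_seg_self (a : ℕ) (v : Fin n) : v ∉ seg n a v := by simp [mem_seg]

theorem dependsOnEdges_growsAt (σ a : ℕ) (v : Fin n) :
    DependsOnEdges (star v (seg n a v)) (growsAt σ a v) := by
  intro G G' hG h
  have hadj : ∀ u ∈ seg n a v, (G.Adj v u ↔ G'.Adj v u) := fun u hu =>
    hG s(v, u) (mem_star.2 ⟨u, hu, rfl⟩)
  refine h.imp (fun ⟨u, hu, h1, h2⟩ => ⟨u, hu, h1, (hadj u hu).1 h2⟩) fun h => ?_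
  rwa [← degIn_congr hadj]

theorem dependsOnEdges_grows (σ a L : ℕ) :
    DependsOnEdges (seg n a (a + L)).sym2 (grows (n := n) σ a L) := by
  refine .biInter fun v hv => (dependsOnEdges_growsAt σ a v).mono fun e he => ?_
  obtain ⟨u, hu, rfl⟩ := mem_star.1 he
  rw [mem_seg] at hv hu
  rw [Finset.mk_mem_sym2_iff, mem_seg, mem_seg]
  omega

theorem le_binomialRandom_real_growsAt {σ a : ℕ} {v : Fin n} (hv : a < v) (p : unitInterval) :
    max (p : ℝ) (binomTail p (v - a) σ) ≤
      (SimpleGraph.binomialRandom (Fin n) p).real (growsAt σ a v) := by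
  refine max_le ?_ ?_
  · let u : Fin n := ⟨v - 1, by omega⟩
    have huv : v ≠ u := by
      intro h
      have := congrArg Fin.val h
      simp only [u] at this
      omega
    rw [← binomialRandom_real_adj (p := p) huv]
    refine measureReal_mono (fun G hG => Or.inl ⟨u, ?_, ?_, hG⟩) (measure_ne_top _ _)
    · rw [mem_seg]; simp only [u]; omega
    · simp only [u]; omega
  · rw [← card_seg (n := n) (a := a) v.2.le,
      ← binomialRandom_real_degIn (p := p) (notMem_seg_self a v)]
    exact measureReal_mono (fun G hG => Or.inr hG) (measure_ne_top _ _)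

theorem le_binomialRandom_real_grows {σ a L : ℕ} (h : a + L ≤ n) (p : unitInterval) :
    ∏ k ∈ Finset.Ico 1 L, max (p : ℝ) (binomTail p k σ) ≤
      (SimpleGraph.binomialRandom (Fin n) p).real (grows σ a L) := by
  have e : ∏ k ∈ Finset.Ico 1 L, max (p : ℝ) (binomTail p k σ) =
      ∏ v ∈ seg n (a + 1) (a + L), max (p : ℝ) (binomTail p (v - a) σ) := by
    have := Finset.prod_map (seg n (a + 1) (a + L)) Fin.valEmbedding
      (fun i => max (p : ℝ) (binomTail p (i - a) σ))
    rw [map_seg h] at this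
    rw [show Finset.Ico (a + 1) (a + L) = Finset.Ico (1 + a) (L + a) by
      rw [add_comm, add_comm L], ← Finset.prod_Ico_add' _ 1 L a] at this
    simpa using this
  -- the edges from `v` to smaller vertices determine `v`, so that these events are independent
  rw [e, grows, binomialRandom_real_biInter _ fun v _ => dependsOnEdges_growsAt σ a v]
  · refine Finset.prod_le_prod (fun v _ => le_max_of_le_left p.2.1) fun v hv => ?_
    exact le_binomialRandom_real_growsAt (by rw [mem_seg] at hv; omega) p
  · intro v _ v' _ hvv'
    rcases lt_or_gt_of_ne hvv' with hlt | hlt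
    · have : v' ∉ seg n a v := by rw [mem_seg]; omega
      exact (disjoint_star hvv'.symm this).symm
    · have : v ∉ seg n a v' := by rw [mem_seg]; omega
      exact disjoint_star hvv' this

theorem cycleGraph_adj_of_val {u v : Fin n} (h : u.val + 1 = v) :
    (SimpleGraph.cycleGraph n).Adj u v :=
  SimpleGraph.pathGraph_le_cycleGraph (SimpleGraph.pathGraph_adj.2 (Or.inl h))

theorem seg_succ_right {a b : ℕ} (hab : a ≤ b) (hb : b < n) :
    seg n a (b + 1) = insert ⟨b, hb⟩ (seg n a b) := by
  ext v
  simp only [Finset.mem_insert, mem_seg, Fin.ext_iff]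
  omega

theorem seg_succ_left {a b : ℕ} (hab : a < b) (ha : a < n) :
    seg n a b = insert ⟨a, ha⟩ (seg n (a + 1) b) := by
  ext v
  simp only [Finset.mem_insert, mem_seg, Fin.ext_iff]
  omega

theorem internallySolved_seg_of_grows {σ a L : ℕ} (hL : 1 ≤ L) (h : a + L ≤ n)
    {G : SimpleGraph (Fin n)} (hG : G ∈ grows σ a L) :
    InternallySolved (SimpleGraph.cycleGraph n) G σ (seg n a (a + L)) := by
  have key : ∀ k, k + 1 ≤ L →
      InternallySolved (SimpleGraph.cycleGraph n) G σ (seg n a (a + (k + 1))) := by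
    intro k
    induction k with
    | zero =>
      intro _
      have : seg n a (a + (0 + 1)) = {⟨a, by omega⟩} := by
        ext v; simp only [mem_seg, Finset.mem_singleton, Fin.ext_iff]; omega
      rw [this]
      exact .singleton _
    | succ k ih =>
      intro hk
      rw [← add_assoc, seg_succ_right (by omega) (by omega)]
      have hv := mem_iInter₂.1 hG ⟨a + (k + 1), by omega⟩ (by rw [mem_seg]; simp; omega)
      have hu : (⟨a + k, by omega⟩ : Fin n) ∈ seg n a (a + (k + 1)) := by
        rw [mem_seg]; simp
      refine (ih (by omega)).insert (notMem_seg_self a _) hu (cycleGraph_adj_of_val rfl).symm ?_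
      refine hv.imp (fun ⟨u, _, h1, h2⟩ => ?_) id
      have : u = ⟨a + k, by omega⟩ := by
        simp only [Fin.ext_iff] at h1 ⊢; omega
      rwa [← this]
  obtain ⟨k, rfl⟩ : ∃ k, L = k + 1 := ⟨L - 1, by omega⟩
  exact key k le_rfl

/-- An internally solved interval spreads over the whole ring if all other vertices have `σ`
people neighbours in it. -/
theorem internallySolved_univ_of_seg {σ a b : ℕ} (hab : a < b) (hb : b ≤ n)
    {G : SimpleGraph (Fin n)}
    (h : InternallySolved (SimpleGraph.cycleGraph n) G σ (seg n a b))
    (hdeg : ∀ v ∉ seg n a b, σ ≤ degIn G v (seg n a b)) :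
    InternallySolved (SimpleGraph.cycleGraph n) G σ Finset.univ := by
  -- the interval first spreads to the right up to `n`, then to the left down to `0`
  have hright : ∀ c, b ≤ c → c ≤ n →
      InternallySolved (SimpleGraph.cycleGraph n) G σ (seg n a c) := by
    intro c hc
    induction c, hc using Nat.le_induction with
    | base => exact fun _ => h
    | succ c hc ih =>
      intro hcn
      rw [seg_succ_right (by omega) (by omega)]
      have hu : (⟨c - 1, by omega⟩ : Fin n) ∈ seg n a c := by rw [mem_seg]; simp; omega
      refine (ih (by omega)).insert (notMem_seg_self a _) hu
        (cycleGraph_adj_of_val (by simp; omega)).symm (Or.inr ?_)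
      refine (hdeg _ (by rw [mem_seg]; simp; omega)).trans (degIn_mono ?_ fun _ _ h => h)
      intro v; rw [mem_seg, mem_seg]; omega
  have hleft : ∀ i ≤ a, InternallySolved (SimpleGraph.cycleGraph n) G σ (seg n (a - i) n) := by
    intro i
    induction i with
    | zero => exact fun _ => hright n hb le_rfl
    | succ i ih =>
      intro hi
      rw [seg_succ_left (by omega) (by omega), show a - (i + 1) + 1 = a - i by omega]
      have hu : (⟨a - i, by omega⟩ : Fin n) ∈ seg n (a - i) n := by rw [mem_seg]; simp; omega
      refine (ih (by omega)).insert (by rw [mem_seg]; simp; omega) hu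
        (cycleGraph_adj_of_val (by simp; omega)) (Or.inr ?_)
      refine (hdeg _ (by rw [mem_seg]; simp; omega)).trans (degIn_mono ?_ fun _ _ h => h)
      intro v; rw [mem_seg, mem_seg]; omega
  have := hleft a le_rfl
  rwa [show seg n (a - a) n = Finset.univ by ext v; simp [mem_seg]] at this

/-- The ring is solved if one of `m` disjoint intervals of length `L` is internally solved and all
vertices have enough people neighbours in each of them. -/
theorem one_sub_ringSolveProb_le {σ m L : ℕ} (hσ : 1 ≤ σ) (hL : σ ≤ L) (hn : m * L ≤ n)
    (hn0 : 0 < n) (p : unitInterval) {r : ℝ}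
    (hr : r ≤ ∏ k ∈ Finset.Ico 1 L, max (p : ℝ) (binomTail p k σ)) :
    1 - ringSolveProb σ n p ≤
      Real.exp (-(m * r)) + n ^ 2 * (σ * Real.exp (-(p * L / (2 * σ)))) := by
  have : Nonempty (Fin n) := ⟨⟨0, hn0⟩⟩
  set μ := SimpleGraph.binomialRandom (Fin n) p
  have hL1 : 1 ≤ L := hσ.trans hL
  have hjn : ∀ j < m, j * L + L ≤ n := fun j hj => by
    have : (j + 1) * L ≤ m * L := Nat.mul_le_mul_right L hj
    linarith
  let I : ℕ → Finset (Fin n) := fun j => seg n (j * L) (j * L + L)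
  let bad : ℕ × Fin n → Set (SimpleGraph (Fin n)) := fun x => {G | σ ≤ degIn G x.2 (I x.1)}ᶜ
  let S : Finset (ℕ × Fin n) := (Finset.range m ×ˢ Finset.univ).filter fun x => x.2 ∉ I x.1
  have hsub : {G | Solves (SimpleGraph.cycleGraph n) G σ 1 ⊤}ᶜ ⊆
      (⋂ j ∈ Finset.range m, (grows σ (j * L) L)ᶜ) ∪ ⋃ x ∈ S, bad x := by
    intro G hG
    by_contra hcon
    simp only [mem_union, mem_iInter, mem_iUnion, not_or, not_forall, not_exists] at hcon
    obtain ⟨⟨j, hj, hj2⟩, hbad⟩ := hcon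
    have hj' := Finset.mem_range.1 hj
    refine hG (solves_iff.2 (internallySolved_univ_of_seg (by omega) (hjn j hj')
      (internallySolved_seg_of_grows hL1 (hjn j hj') (by simpa using hj2)) fun v hv => ?_))
    have := hbad (j, v) (Finset.mem_filter.2 ⟨Finset.mem_product.2 ⟨hj, Finset.mem_univ _⟩, hv⟩)
    simpa [bad] using this
  have hgrow : μ.real (⋂ j ∈ Finset.range m, (grows σ (j * L) L)ᶜ) ≤ Real.exp (-(m * r)) := by
    rw [binomialRandom_real_biInter _ (fun j _ => (dependsOnEdges_grows σ (j * L) L).compl)]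
    · calc ∏ j ∈ Finset.range m, μ.real (grows σ (j * L) L)ᶜ
          ≤ ∏ j ∈ Finset.range m, Real.exp (-r) := by
            refine Finset.prod_le_prod (fun _ _ => measureReal_nonneg) fun j hj => ?_
            rw [probReal_compl_eq_one_sub (measurableSet_graphs _)]
            have h1 := hr.trans (le_binomialRandom_real_grows (σ := σ)
              (hjn j (Finset.mem_range.1 hj)) p)
            have h2 := Real.add_one_le_exp (-r)
            linarith
        _ = Real.exp (-(m * r)) := by
            rw [Finset.prod_const, Finset.card_range, ← Real.exp_nat_mul]; ring_nf
    · intro j _ j' _ hjj'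
      refine disjoint_sym2 ?_
      rcases lt_or_gt_of_ne hjj' with hlt | hlt
      · refine disjoint_seg ?_
        have : (j + 1) * L ≤ j' * L := Nat.mul_le_mul_right L hlt
        linarith
      · refine (disjoint_seg ?_).symm
        have : (j' + 1) * L ≤ j * L := Nat.mul_le_mul_right L hlt
        linarith
  have hbad : ∀ x ∈ S, μ.real (bad x) ≤ σ * Real.exp (-(p * L / (2 * σ))) := by
    intro x hx
    obtain ⟨hx1, hx2⟩ := Finset.mem_filter.1 hx
    have hx3 := hjn x.1 (Finset.mem_range.1 (Finset.mem_product.1 hx1).1)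
    rw [probReal_compl_eq_one_sub (measurableSet_graphs _), binomialRandom_real_degIn hx2,
      card_seg hx3, Nat.add_sub_cancel_left]
    have h0 : 0 ≤ (p : ℝ) * L := mul_nonneg p.2.1 (Nat.cast_nonneg L)
    have h1 := binomTail_ge p.2.1 p.2.2 hσ hL h0 le_rfl
    have h2 : Real.exp (-(p * L / (2 * σ))) ≤ 1 :=
      Real.exp_le_one_iff.2 (by simp only [Left.neg_nonpos_iff]; positivity)
    have h3 := one_add_mul_le_pow (a := -Real.exp (-(p * L / (2 * σ)))) (by linarith) σ
    rw [← sub_eq_add_neg] at h3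
    linarith
  have hS : (S.card : ℝ) ≤ n ^ 2 := by
    have h1 : S.card ≤ m * n := by
      refine (Finset.card_filter_le _ _).trans ?_
      simp
    have h2 : m ≤ n := by nlinarith
    have : S.card ≤ n ^ 2 := by nlinarith
    exact_mod_cast this
  have hc : 1 - ringSolveProb σ n p =
      μ.real {G | Solves (SimpleGraph.cycleGraph n) G σ 1 ⊤}ᶜ := by
    rw [probReal_compl_eq_one_sub (measurableSet_graphs _)]; rfl
  rw [hc]
  calc _ ≤ μ.real ((⋂ j ∈ Finset.range m, (grows σ (j * L) L)ᶜ) ∪ ⋃ x ∈ S, bad x) :=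
        measureReal_mono hsub (measure_ne_top _ _)
    _ ≤ Real.exp (-(m * r)) + ∑ x ∈ S, μ.real (bad x) :=
        (measureReal_union_le _ _).trans
          (add_le_add hgrow (measureReal_biUnion_finset_le _ _))
    _ ≤ Real.exp (-(m * r)) + S.card * (σ * Real.exp (-(p * L / (2 * σ)))) := by
        gcongr
        simpa using Finset.sum_le_sum hbad
    _ ≤ _ := by gcongr

end Growth

/-! ### Existence and uniqueness of the critical probability -/

section BernoulliSum

variable {ι : Type*} [DecidableEq ι]

/-- The expectation of `F` at a random subset of `U` containing each element independently with
probability `p`. -/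
def bernoulliSum (U : Finset ι) (F : Finset ι → ℝ) (p : ℝ) : ℝ :=
  ∑ s ∈ U.powerset, p ^ s.card * (1 - p) ^ (U \ s).card * F s

theorem continuous_bernoulliSum (U : Finset ι) (F : Finset ι → ℝ) :
    Continuous (bernoulliSum U F) := by
  unfold bernoulliSum
  fun_prop

/-- Conditioning on whether the element `e` is present. -/
theorem bernoulliSum_insert {U : Finset ι} {e : ι} (he : e ∉ U) (F : Finset ι → ℝ) (p : ℝ) :
    bernoulliSum (insert e U) F p =
      (1 - p) * bernoulliSum U F p + p * bernoulliSum U (fun s => F (insert e s)) p := by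
  unfold bernoulliSum
  rw [Finset.sum_powerset_insert he, Finset.mul_sum, Finset.mul_sum]
  congr 1
  · refine Finset.sum_congr rfl fun s hs => ?_
    have hes : e ∉ s := fun h => he (Finset.mem_powerset.1 hs h)
    rw [Finset.insert_sdiff_of_notMem _ hes, Finset.card_insert_of_notMem (by simp [he])]
    ring
  · refine Finset.sum_congr rfl fun s hs => ?_
    have hes : e ∉ s := fun h => he (Finset.mem_powerset.1 hs h)
    have : insert e U \ insert e s = U \ s := by
      ext x
      simp only [Finset.mem_sdiff, Finset.mem_insert]
      by_cases hx : x = e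
      · subst hx; simp [he]
      · simp [hx]
    rw [this, Finset.card_insert_of_notMem hes]
    ring

theorem bernoulliSum_mono_right (U : Finset ι) {F F' : Finset ι → ℝ} (h : ∀ s, F s ≤ F' s)
    {p : ℝ} (h0 : 0 ≤ p) (h1 : p ≤ 1) : bernoulliSum U F p ≤ bernoulliSum U F' p := by
  refine Finset.sum_le_sum fun s _ => mul_le_mul_of_nonneg_left (h s) ?_
  have : 0 ≤ 1 - p := by linarith
  positivity

theorem bernoulliSum_lt_right (U : Finset ι) {F F' : Finset ι → ℝ} (h : ∀ s, F s ≤ F' s)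
    (hU : F U < F' U) {p : ℝ} (h0 : 0 < p) (h1 : p ≤ 1) :
    bernoulliSum U F p < bernoulliSum U F' p := by
  refine Finset.sum_lt_sum (fun s _ => mul_le_mul_of_nonneg_left (h s) ?_)
    ⟨U, Finset.mem_powerset_self U, ?_⟩
  · have : 0 ≤ 1 - p := by linarith
    positivity
  · refine mul_lt_mul_of_pos_left hU ?_
    rw [Finset.sdiff_self, Finset.card_empty, pow_zero, mul_one]
    positivity

theorem bernoulliSum_mono (U : Finset ι) {F : Finset ι → ℝ} (hF : Monotone F) {p q : ℝ}
    (h0 : 0 ≤ p) (hpq : p ≤ q) (h1 : q ≤ 1) : bernoulliSum U F p ≤ bernoulliSum U F q := by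
  induction U using Finset.induction_on generalizing F with
  | empty => simp [bernoulliSum]
  | insert e U he ih =>
    rw [bernoulliSum_insert he, bernoulliSum_insert he]
    have a := ih hF
    have b := ih (F := fun s => F (insert e s)) fun s t h => hF (Finset.insert_subset_insert e h)
    have c := bernoulliSum_mono_right U (F' := fun s => F (insert e s))
      (fun s => hF (Finset.subset_insert e s)) (h0.trans hpq) h1
    nlinarith

theorem bernoulliSum_lt (U : Finset ι) {F : Finset ι → ℝ} (hF : Monotone F) (hFU : F ∅ < F U)
    {p q : ℝ} (h0 : 0 ≤ p) (hpq : p < q) (h1 : q ≤ 1) :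
    bernoulliSum U F p < bernoulliSum U F q := by
  induction U using Finset.induction_on generalizing F with
  | empty => exact absurd hFU (lt_irrefl _)
  | insert e U he ih =>
    rw [bernoulliSum_insert he, bernoulliSum_insert he]
    have hF' : Monotone fun s => F (insert e s) :=
      fun s t h => hF (Finset.insert_subset_insert e h)
    have b := bernoulliSum_mono U hF' h0 hpq.le h1
    have hle : ∀ s, F s ≤ F (insert e s) := fun s => hF (Finset.subset_insert e s)
    have c := bernoulliSum_mono_right U hle (h0.trans hpq.le) h1
    by_cases hU : F ∅ < F U
    · have a := ih hF hU
      nlinarith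
    · have a := bernoulliSum_mono U hF h0 hpq.le h1
      have d := bernoulliSum_lt_right U hle (lt_of_le_of_lt (not_lt.1 hU) hFU)
        (lt_of_le_of_lt h0 hpq) h1
      nlinarith

end BernoulliSum

section Events

variable {V : Type*} [DecidableEq V] [Fintype V]

/-- The pairs of distinct vertices. -/
def allEdges (V : Type*) [DecidableEq V] [Fintype V] : Finset (Sym2 V) :=
  Finset.univ.filter fun e => ¬ e.IsDiag

theorem coe_allEdges : (allEdges V : Set (Sym2 V)) = Sym2.diagSetᶜ := by
  ext e; simp [allEdges]

open Classical in
theorem binomialRandom_real_eq_bernoulliSum (p : unitInterval) (A : Set (SimpleGraph V)) :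
    (SimpleGraph.binomialRandom V p).real A = bernoulliSum (allEdges V)
      (fun s => if SimpleGraph.fromEdgeSet (s : Set (Sym2 V)) ∈ A then 1 else 0) p := by
  have e1 : (SimpleGraph.binomialRandom V p).real A =
      (setBernoulli (allEdges V : Set (Sym2 V)) p).real (SimpleGraph.fromEdgeSet ⁻¹' A) := by
    rw [SimpleGraph.binomialRandom_eq_map, coe_allEdges, measureReal_def, measureReal_def,
      Measure.map_apply SimpleGraph.measurable_fromEdgeSet (measurableSet_graphs A)]
  let S : Finset (Finset (Sym2 V)) := (allEdges V).powerset.filter fun s => SimpleGraph.fromEdgeSet (s : Set (Sym2 V)) ∈ A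
  have e2 : {s | s ∈ SimpleGraph.fromEdgeSet ⁻¹' A ∧ s ⊆ (allEdges V : Set (Sym2 V))} =
      ⋃ s ∈ S, {(s : Set (Sym2 V))} := by
    ext s
    simp only [mem_ofPred_eq, mem_preimage, mem_iUnion, mem_singleton_iff, S, Finset.mem_filter,
      Finset.mem_powerset]
    constructor
    · rintro ⟨h1, h2⟩
      refine ⟨s.toFinite.toFinset, ⟨?_, by simpa using h1⟩, by simp⟩
      intro e he
      exact h2 (by simpa using he)
    · rintro ⟨t, ⟨h1, h2⟩, rfl⟩
      exact ⟨h2, Finset.coe_subset.2 h1⟩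
  rw [e1, measureReal_def, setBernoulli_apply_eq_apply_subsets, ← measureReal_def, e2,
    measureReal_biUnion_finset]
  · rw [bernoulliSum, Finset.sum_filter]
    refine Finset.sum_congr rfl fun s hs => ?_
    split_ifs
    · rw [setBernoulli_real_singleton p (Finset.coe_subset.2 (Finset.mem_powerset.1 hs))
        (Finset.finite_toSet _), ← Finset.coe_sdiff, Set.ncard_coe_finset, Set.ncard_coe_finset,
        mul_one]
    · simp
  · intro s _ t _ hst
    simpa using hst
  · exact fun s _ => measurableSet_singleton _

theorem continuous_binomialRandom_real (A : Set (SimpleGraph V)) :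
    Continuous fun p : unitInterval => (SimpleGraph.binomialRandom V p).real A := by
  classical
  simp_rw [binomialRandom_real_eq_bernoulliSum]
  exact (continuous_bernoulliSum _ _).comp continuous_subtype_val

/-- The probability of a non-trivial increasing event is strictly increasing. -/
theorem strictMono_binomialRandom_real {A : Set (SimpleGraph V)} (hA : IsUpperSet A)
    (h0 : ⊥ ∉ A) (h1 : ⊤ ∈ A) :
    StrictMono fun p : unitInterval => (SimpleGraph.binomialRandom V p).real A := by
  classical
  intro p q hpq
  simp only [binomialRandom_real_eq_bernoulliSum]
  refine bernoulliSum_lt _ ?_ ?_ p.2.1 hpq q.2.2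
  · intro s t hst
    dsimp only
    split_ifs with h2 h3
    · exact le_rfl
    · exact absurd (hA (SimpleGraph.fromEdgeSet_mono (Finset.coe_subset.2 hst)) h2) h3
    · exact zero_le_one
    · exact le_rfl
  · have e : SimpleGraph.fromEdgeSet (allEdges V : Set (Sym2 V)) = ⊤ := by
      ext u v; simp [coe_allEdges]
    rw [e, if_pos h1, Finset.coe_empty, SimpleGraph.fromEdgeSet_empty, if_neg h0]
    exact one_pos

end Events

section Critical

variable {σ n : ℕ}

theorem isUpperSet_solves (hn : 2 ≤ n) :
    IsUpperSet {G : SimpleGraph (Fin n) | Solves (SimpleGraph.cycleGraph n) G σ 1 ⊤} := by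
  have : Nonempty (Fin n) := ⟨⟨0, by omega⟩⟩
  intro G G' h hG
  exact solves_iff.2 ((solves_iff.1 hG).mono h)

theorem not_solves_bot (hσ : 1 ≤ σ) (hn : 2 ≤ n) :
    ¬ Solves (SimpleGraph.cycleGraph n) (⊥ : SimpleGraph (Fin n)) σ 1 ⊤ := by
  have : Nonempty (Fin n) := ⟨⟨0, by omega⟩⟩
  intro h
  rcases (solves_iff.1 h).good hσ (by simpa using hn) (Finset.mem_univ ⟨0, by omega⟩) with
    ⟨u, -, -, h⟩ | h
  · exact h
  · simp [degIn] at h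
    omega

theorem solves_top (hn : 2 ≤ n) :
    Solves (SimpleGraph.cycleGraph n) (⊤ : SimpleGraph (Fin n)) σ 1 ⊤ := by
  have : Nonempty (Fin n) := ⟨⟨0, by omega⟩⟩
  rw [solves_iff]
  have h : (⊤ : SimpleGraph (Fin n)) ∈ grows (n := n) σ 0 n := by
    refine mem_iInter₂.2 fun v hv => Or.inl ?_
    rw [mem_seg] at hv
    have hu : ((⟨v - 1, by omega⟩ : Fin n) : ℕ) + 1 = v := by simp only; omega
    refine ⟨⟨v - 1, by omega⟩, by rw [mem_seg]; simp only; omega, hu, ?_⟩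
    rw [SimpleGraph.top_adj]
    intro h
    rw [← h] at hu
    omega
  have := internallySolved_seg_of_grows (by omega) (by omega) h
  rwa [show seg n 0 (0 + n) = Finset.univ by ext v; simp [mem_seg]] at this

theorem strictMono_ringSolveProb (hσ : 1 ≤ σ) (hn : 2 ≤ n) : StrictMono (ringSolveProb σ n) :=
  strictMono_binomialRandom_real (isUpperSet_solves hn) (not_solves_bot hσ hn) (solves_top hn)

theorem ringSolveProb_nonneg (p : unitInterval) : 0 ≤ ringSolveProb σ n p := measureReal_nonneg

theorem ringSolveProb_le_one (hn : 2 ≤ n) (p : unitInterval) : ringSolveProb σ n p ≤ 1 := by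
  have : Nonempty (Fin n) := ⟨⟨0, by omega⟩⟩
  exact measureReal_le_one

theorem existsUnique_isCriticalProb (hσ : 1 ≤ σ) (hn : 2 ≤ n) :
    ∃! p : unitInterval, IsCriticalProb (ringSolveProb σ n) p := by
  have hc : Continuous (ringSolveProb σ n) :=
    continuous_binomialRandom_real {G | Solves (SimpleGraph.cycleGraph n) G σ 1 ⊤}
  have h0 : ringSolveProb σ n 0 = 0 := by
    rw [ringSolveProb, solveProb, SimpleGraph.binomialRandom_zero, measureReal_def,
      Measure.dirac_apply' _ (measurableSet_graphs _),
      indicator_of_notMem (by exact not_solves_bot hσ hn)]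
    simp
  have h1 : ringSolveProb σ n 1 = 1 := by
    rw [ringSolveProb, solveProb, SimpleGraph.binomialRandom_one, measureReal_def,
      Measure.dirac_apply' _ (measurableSet_graphs _),
      indicator_of_mem (by exact solves_top hn)]
    simp
  obtain ⟨p, hp⟩ := mem_range_of_exists_le_of_exists_ge hc (c := (1 / 2 : ℝ))
    ⟨0, by rw [h0]; norm_num⟩ ⟨1, by rw [h1]; norm_num⟩
  exact ⟨p, hp, fun q hq => (strictMono_ringSolveProb hσ hn).injective (hq.trans hp.symm)⟩

end Critical

/-! ### The sharp threshold -/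

theorem tendsto_log_natCast_atTop : Tendsto (fun n : ℕ => Real.log (n : ℝ)) atTop atTop :=
  Real.tendsto_log_atTop.comp tendsto_natCast_atTop_atTop

theorem tendsto_pow_mul_exp_neg_mul (k : ℕ) {ρ : ℝ} (hρ : 0 < ρ) :
    Tendsto (fun y : ℝ => y ^ k * Real.exp (-(ρ * y))) atTop (𝓝 0) := by
  have h1 := (Real.tendsto_pow_mul_exp_neg_atTop_nhds_zero k).comp
    (tendsto_id.const_mul_atTop hρ)
  have h2 := h1.const_mul ((ρ ^ k)⁻¹)
  rw [mul_zero] at h2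
  refine h2.congr fun y => ?_
  simp only [Function.comp_apply, id_eq, mul_pow]
  field_simp

theorem tendsto_const_div_log_nhdsGT {a : ℝ} (ha : 0 < a) :
    Tendsto (fun n : ℕ => a / Real.log (n : ℝ)) atTop (𝓝[>] 0) := by
  refine tendsto_nhdsWithin_iff.2 ⟨tendsto_log_natCast_atTop.const_div_atTop a, ?_⟩
  filter_upwards [tendsto_log_natCast_atTop.eventually_gt_atTop 0] with n hn
  exact div_pos ha hn

/-- Below the threshold `λ_σ / log n` the ring is not solved. -/
theorem tendsto_ringSolveProb_zero {σ : ℕ} (hσ : 1 ≤ σ) {ε : ℝ} (hε0 : 0 < ε) (hε1 : ε < 1) :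
    Tendsto (fun n : ℕ => ringSolveProb σ n
      (projIcc 0 1 zero_le_one ((1 - ε) * ringConst σ / Real.log n))) atTop (𝓝 0) := by
  have hlam := ringConst_pos hσ
  set lam := ringConst σ
  have ha : 0 < (1 - ε) * lam := mul_pos (by linarith) hlam
  obtain ⟨C, hC, hev⟩ := eventually_internallySolved_le hσ (η := ε * lam / 2) (by positivity)
  have hx := tendsto_const_div_log_nhdsGT ha
  set ρ := (ε / 2) / (1 - ε)
  have hρ : 0 < ρ := div_pos (by linarith) (by linarith)
  have hB : Tendsto (fun n : ℕ => (2 * C / ((1 - ε) * lam)) *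
      (Real.log (n : ℝ) ^ 1 * Real.exp (-(ρ * Real.log (n : ℝ))))) atTop (𝓝 0) := by
    have := ((tendsto_pow_mul_exp_neg_mul 1 hρ).comp tendsto_log_natCast_atTop).const_mul
      (2 * C / ((1 - ε) * lam))
    rwa [mul_zero] at this
  have hlog : ∀ᶠ n : ℕ in atTop, C / ((1 - ε) * lam) * Real.log (n : ℝ) ≤ n := by
    have h1 := (Real.isLittleO_log_id_atTop.def (c := ((1 - ε) * lam) / C) (by positivity))
    filter_upwards [tendsto_natCast_atTop_atTop.eventually h1] with n hn
    simp only [id_eq, Real.norm_eq_abs, Nat.abs_cast] at hn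
    have h2 := (le_abs_self _).trans hn
    calc C / ((1 - ε) * lam) * Real.log (n : ℝ) ≤ C / ((1 - ε) * lam) * ((1 - ε) * lam / C * n) := by
          gcongr
      _ = n := by
          have : 1 - ε ≠ 0 := by linarith
          field_simp
  refine squeeze_zero' (Eventually.of_forall fun n => ringSolveProb_nonneg _) ?_ hB
  filter_upwards [hx.eventually hev, hx.eventually (Ioo_mem_nhdsGT one_pos), hlog,
    eventually_ge_atTop 2, tendsto_log_natCast_atTop.eventually_gt_atTop 0]
    with n hK hx1 hlogn hn2 hy
  set y := Real.log (n : ℝ) with hy_def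
  set x := (1 - ε) * lam / y with hxdef
  obtain ⟨K, hK1, hK2, hK3⟩ := hK
  have hn0 : (0:ℝ) < n := by positivity
  set p := projIcc (0:ℝ) 1 zero_le_one x with hp
  have hpx : (p : ℝ) = x := by
    rw [hp, projIcc_of_mem zero_le_one ⟨hx1.1.le, hx1.2.le⟩]
  have hCx : C / x = C / ((1 - ε) * lam) * y := by rw [hxdef]; field_simp
  have hKn : K ≤ n := by
    have : (K : ℝ) ≤ n := hK2.trans (hCx ▸ hlogn)
    exact_mod_cast this
  refine (ringSolveProb_le hn2 hK1 hKn (Real.exp_pos _).le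
    fun s hs I hI1 hI2 => hK3 p hpx (Fin n) _ s hs I hI1 hI2).trans ?_
  have he : -(lam - ε * lam / 2) / x = -y - ρ * y := by
    have h1 : 1 - ε ≠ 0 := by linarith
    simp only [hxdef, ρ]
    field_simp
    ring
  have hexp : (n : ℝ) * Real.exp (-y - ρ * y) = Real.exp (-(ρ * y)) := by
    rw [sub_eq_add_neg, Real.exp_add, ← mul_assoc, Real.exp_neg y, hy_def, Real.exp_log hn0,
      mul_inv_cancel₀ hn0.ne', one_mul]
  rw [he]
  calc (n : ℝ) * (2 * K) * Real.exp (-y - ρ * y)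
      = 2 * K * ((n : ℝ) * Real.exp (-y - ρ * y)) := by ring
    _ = 2 * K * Real.exp (-(ρ * y)) := by rw [hexp]
    _ ≤ 2 * (C / ((1 - ε) * lam) * y) * Real.exp (-(ρ * y)) := by
        rw [hCx] at hK2
        gcongr
    _ = _ := by ring

/-- Above the threshold `λ_σ / log n` the ring is solved. -/
theorem tendsto_ringSolveProb_one {σ : ℕ} (hσ : 1 ≤ σ) {ε : ℝ} (hε0 : 0 < ε) :
    Tendsto (fun n : ℕ => ringSolveProb σ n
      (projIcc 0 1 zero_le_one ((1 + ε) * ringConst σ / Real.log n))) atTop (𝓝 1) := by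
  have hlam := ringConst_pos hσ
  set lam := ringConst σ
  have ha : 0 < (1 + ε) * lam := mul_pos (by linarith) hlam
  have hev := eventually_exp_le_prod_binomTail hσ (η := ε * lam / 2) (by positivity)
  have hx := tendsto_const_div_log_nhdsGT ha
  set ρ := (ε / 2) / (1 + ε) with hρdef
  have hρ : 0 < ρ := div_pos (by linarith) (by linarith)
  have hσ0 : (0 : ℝ) < σ := by positivity
  set D := 6 * σ / ((1 + ε) * lam) with hD
  have hD0 : 0 < D := by positivity
  -- the expected number of intervals of length `L ≤ D * y ^ 2 + 1` which grow, with `y = log n`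
  have hm : Tendsto (fun y : ℝ => ((D * y ^ 2 + 1) * Real.exp (-(ρ * y)))⁻¹ - 1) atTop atTop := by
    have h1 : Tendsto (fun y : ℝ => (D * y ^ 2 + 1) * Real.exp (-(ρ * y))) atTop (𝓝[>] 0) := by
      refine tendsto_nhdsWithin_iff.2 ⟨?_, Eventually.of_forall fun y => ?_⟩
      · have := ((tendsto_pow_mul_exp_neg_mul 2 hρ).const_mul D).add
          (tendsto_pow_mul_exp_neg_mul 0 hρ)
        rw [mul_zero, add_zero] at this
        refine this.congr fun y => by ring
      · exact mul_pos (by positivity) (Real.exp_pos _)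
    exact tendsto_atTop_add_const_right _ _ (tendsto_inv_nhdsGT_zero.comp h1)
  have hB : Tendsto (fun n : ℕ => Real.exp (-(((D * Real.log (n:ℝ) ^ 2 + 1) *
      Real.exp (-(ρ * Real.log (n:ℝ))))⁻¹ - 1)) + σ * ((n : ℝ))⁻¹) atTop (𝓝 0) := by
    have h1 := (Real.tendsto_exp_neg_atTop_nhds_zero.comp hm).comp tendsto_log_natCast_atTop
    have h2 := (tendsto_inv_atTop_nhds_zero_nat (𝕜 := ℝ)).const_mul (σ : ℝ)
    have := h1.add h2
    rwa [mul_zero, add_zero] at this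
  have key : Tendsto (fun n : ℕ => 1 - ringSolveProb σ n
      (projIcc 0 1 zero_le_one ((1 + ε) * lam / Real.log n))) atTop (𝓝 0) := by
    refine squeeze_zero' ?_ ?_ hB
    · filter_upwards [eventually_ge_atTop 2] with n hn
      linarith [ringSolveProb_le_one (σ := σ) hn
        (projIcc 0 1 zero_le_one ((1 + ε) * lam / Real.log n))]
    filter_upwards [hx.eventually hev, hx.eventually (Ioo_mem_nhdsGT one_pos),
      eventually_ge_atTop 2, tendsto_log_natCast_atTop.eventually_gt_atTop 1]
      with n hK hx1 hn2 hy
    set y := Real.log (n : ℝ) with hy_def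
    set x := (1 + ε) * lam / y with hxdef
    have hn0 : (0:ℝ) < n := by positivity
    have hy0 : 0 < y := by linarith
    have hx0 : 0 < x := hx1.1
    set p := projIcc (0:ℝ) 1 zero_le_one x with hp
    have hpx : (p : ℝ) = x := by
      rw [hp, projIcc_of_mem zero_le_one ⟨hx1.1.le, hx1.2.le⟩]
    -- this length makes a given vertex lack neighbours in a given interval with probability `O(n⁻³)`
    set L := ⌈6 * σ * y / x⌉₊
    have hL1 : 6 * σ * y / x ≤ L := Nat.le_ceil _
    have hL2 : (L : ℝ) ≤ D * y ^ 2 + 1 := by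
      refine (Nat.ceil_lt_add_one (by positivity)).le.trans (le_of_eq ?_)
      rw [hxdef, hD]; field_simp
    rw [div_le_iff₀ hx0] at hL1
    have hLσ : σ ≤ L := by
      have : (σ : ℝ) ≤ L := by
        have h1 : (σ : ℝ) ≤ 6 * σ * y := by nlinarith
        have h2 : (L : ℝ) * x ≤ L * 1 := by gcongr; exact hx1.2.le
        linarith
      exact_mod_cast this
    have hL0 : (0 : ℝ) < L := by exact_mod_cast (by omega : 0 < L)
    have hmL : n / L * L ≤ n := Nat.div_mul_le_self n L
    have hr := hK L
    rw [← hpx] at hr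
    refine (one_sub_ringSolveProb_le hσ hLσ hmL (by omega) p hr).trans ?_
    refine add_le_add ?_ ?_
    · refine Real.exp_le_exp.2 (neg_le_neg ?_)
      have he : -(lam + ε * lam / 2) / (p : ℝ) = -y + ρ * y := by
        have h1 : 1 + ε ≠ 0 := by linarith
        rw [hpx, hxdef, hρdef]
        field_simp
        ring
      have hexp : (n : ℝ) * Real.exp (-y + ρ * y) = Real.exp (ρ * y) := by
        rw [Real.exp_add, ← mul_assoc, Real.exp_neg y, hy_def, Real.exp_log hn0,
          mul_inv_cancel₀ hn0.ne', one_mul]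
      have hmn : (n : ℝ) / L - 1 ≤ ((n / L : ℕ) : ℝ) := by
        have h1 := Nat.lt_div_mul_add (a := n) (b := L) (by omega)
        have h2 : (n : ℝ) < ((n / L : ℕ) : ℝ) * L + L := by exact_mod_cast h1
        rw [sub_le_iff_le_add, div_le_iff₀ hL0]
        linarith
      have hle1 : Real.exp (-y + ρ * y) ≤ 1 := by
        refine Real.exp_le_one_iff.2 ?_
        have : ρ ≤ 1 := by rw [hρdef, div_le_one (by linarith)]; linarith
        nlinarith
      rw [he]
      calc ((D * y ^ 2 + 1) * Real.exp (-(ρ * y)))⁻¹ - 1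
          = Real.exp (ρ * y) / (D * y ^ 2 + 1) - 1 := by
            rw [mul_inv, ← Real.exp_neg, neg_neg]; ring
        _ ≤ Real.exp (ρ * y) / L - Real.exp (-y + ρ * y) := by gcongr
        _ = ((n : ℝ) / L - 1) * Real.exp (-y + ρ * y) := by rw [← hexp]; ring
        _ ≤ _ := by gcongr
    · have h1 : 3 * y ≤ p * L / (2 * σ) := by
        rw [hpx, le_div_iff₀ (by positivity)]
        linarith
      have h2 : Real.exp (-(p * L / (2 * σ))) ≤ ((n : ℝ)⁻¹) ^ 3 := by
        calc Real.exp (-(p * L / (2 * σ))) ≤ Real.exp (((3 : ℕ) : ℝ) * -y) :=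
              Real.exp_le_exp.2 (by push_cast; linarith)
          _ = ((n : ℝ)⁻¹) ^ 3 := by
              rw [Real.exp_nat_mul, Real.exp_neg, hy_def, Real.exp_log hn0]
      calc (n : ℝ) ^ 2 * (σ * Real.exp (-(p * L / (2 * σ))))
          ≤ (n : ℝ) ^ 2 * (σ * ((n : ℝ)⁻¹) ^ 3) := by gcongr
        _ = σ * (n : ℝ)⁻¹ := by field_simp
  have := key.const_sub 1
  simpa using this

section Threshold

variable {σ : ℕ} {pc : ℕ → unitInterval}

theorem eventually_lt_criticalProb (hσ : 1 ≤ σ)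
    (hpc : ∀ n : ℕ, 2 ≤ n → IsCriticalProb (ringSolveProb σ n) (pc n)) {ε : ℝ} (hε0 : 0 < ε)
    (hε1 : ε < 1) :
    ∀ᶠ n : ℕ in atTop, (1 - ε) * ringConst σ / Real.log n < pc n := by
  have h := (tendsto_order.1 (tendsto_ringSolveProb_zero hσ hε0 hε1)).2 (1 / 2) (by norm_num)
  filter_upwards [h, eventually_ge_atTop 2] with n hn hn2
  rw [← show ringSolveProb σ n (pc n) = 1 / 2 from hpc n hn2,
    (strictMono_ringSolveProb hσ hn2).lt_iff_lt, ← Subtype.coe_lt_coe, coe_projIcc] at hn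
  have h1 := (pc n).2.2
  rcases min_choice 1 ((1 - ε) * ringConst σ / Real.log n) with h2 | h2
  · rw [h2] at hn
    exact absurd ((le_max_right _ _).trans_lt hn) (not_lt.2 h1)
  · rw [h2] at hn
    exact (le_max_right _ _).trans_lt hn

theorem eventually_criticalProb_lt (hσ : 1 ≤ σ)
    (hpc : ∀ n : ℕ, 2 ≤ n → IsCriticalProb (ringSolveProb σ n) (pc n)) {ε : ℝ} (hε0 : 0 < ε) :
    ∀ᶠ n : ℕ in atTop, (pc n : ℝ) < (1 + ε) * ringConst σ / Real.log n := by
  have h := (tendsto_order.1 (tendsto_ringSolveProb_one hσ hε0)).1 (1 / 2) (by norm_num)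
  filter_upwards [h, eventually_ge_atTop 2] with n hn hn2
  rw [← show ringSolveProb σ n (pc n) = 1 / 2 from hpc n hn2,
    (strictMono_ringSolveProb hσ hn2).lt_iff_lt, ← Subtype.coe_lt_coe, coe_projIcc] at hn
  rcases lt_max_iff.1 hn with h1 | h1
  · exact absurd h1 (not_lt.2 (pc n).2.1)
  · exact h1.trans_le (min_le_right _ _)

theorem tendsto_criticalProb_mul_log (hσ : 1 ≤ σ)
    (hpc : ∀ n : ℕ, 2 ≤ n → IsCriticalProb (ringSolveProb σ n) (pc n)) :
    Tendsto (fun n : ℕ => (pc n : ℝ) * Real.log (n : ℝ)) atTop (𝓝 (ringConst σ)) := by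
  have hlam := ringConst_pos hσ
  rw [tendsto_order]
  constructor
  · intro b hb
    set ε := min (1 / 2) ((ringConst σ - b) / ringConst σ)
    have hε0 : 0 < ε := lt_min (by norm_num) (div_pos (by linarith) hlam)
    have hε1 : ε < 1 := (min_le_left _ _).trans_lt (by norm_num)
    have hε2 : ε * ringConst σ ≤ ringConst σ - b := (le_div_iff₀ hlam).1 (min_le_right _ _)
    filter_upwards [eventually_lt_criticalProb hσ hpc hε0 hε1,
      tendsto_log_natCast_atTop.eventually_gt_atTop 0] with n hn hy
    rw [div_lt_iff₀ hy] at hn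
    linarith
  · intro b hb
    set ε := (b - ringConst σ) / ringConst σ
    have hε0 : 0 < ε := div_pos (by linarith) hlam
    have hε2 : ε * ringConst σ = b - ringConst σ := div_mul_cancel₀ _ hlam.ne'
    filter_upwards [eventually_criticalProb_lt hσ hpc hε0,
      tendsto_log_natCast_atTop.eventually_gt_atTop 0] with n hn hy
    rw [lt_div_iff₀ hy] at hn
    linarith

theorem sharpTransition_ringSolveProb (hσ : 1 ≤ σ)
    (hpc : ∀ n : ℕ, 2 ≤ n → IsCriticalProb (ringSolveProb σ n) (pc n)) :
    SharpTransition (ringSolveProb σ) pc := by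
  have hlam := ringConst_pos hσ
  intro ε hε
  constructor
  -- `(1 - δ) * (1 + δ) < 1`, and `δ < 1` also covers `ε ≥ 1`, where `(1 - ε) * pc` is truncated
  · set δ := min ε (1 / 2)
    have hδ0 : 0 < δ := lt_min hε (by norm_num)
    have hδ1 : δ ≤ 1 / 2 := min_le_right _ _
    refine squeeze_zero' (Eventually.of_forall fun n => ringSolveProb_nonneg _) ?_
      (tendsto_ringSolveProb_zero hσ (ε := δ ^ 2) (by positivity) (by nlinarith))
    filter_upwards [eventually_criticalProb_lt hσ hpc hδ0, eventually_ge_atTop 2] with n hn hn2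
    refine (strictMono_ringSolveProb hσ hn2).monotone (monotone_projIcc _ ?_)
    calc (1 - ε) * (pc n : ℝ) ≤ (1 - δ) * pc n := by
          have := (pc n).2.1
          have := min_le_left ε (1 / 2)
          gcongr
      _ ≤ (1 - δ) * ((1 + δ) * ringConst σ / Real.log n) := by
          have : 0 ≤ 1 - δ := by linarith
          gcongr
      _ = _ := by ring
  · set δ := ε / (2 * (1 + ε)) with hδ
    have hδ0 : 0 < δ := by positivity
    have hδ1 : δ < 1 := by rw [hδ, div_lt_one (by positivity)]; linarith
    have hδ2 : (1 + ε) * (1 - δ) = 1 + ε / 2 := by rw [hδ]; field_simp; ring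
    refine tendsto_of_tendsto_of_tendsto_of_le_of_le'
      (tendsto_ringSolveProb_one hσ (ε := ε / 2) (by positivity)) tendsto_const_nhds ?_ ?_
    · filter_upwards [eventually_lt_criticalProb hσ hpc hδ0 hδ1, eventually_ge_atTop 2]
        with n hn hn2
      refine (strictMono_ringSolveProb hσ hn2).monotone (monotone_projIcc _ ?_)
      calc (1 + ε / 2) * ringConst σ / Real.log n
          = (1 + ε) * ((1 - δ) * ringConst σ / Real.log n) := by rw [← hδ2]; ring
        _ ≤ _ := by gcongr
    · filter_upwards [eventually_ge_atTop 2] with n hn2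
      exact ringSolveProb_le_one hn2 _

end Threshold

end Jigsaw

end

theorem theorem4 (σ : ℕ) (hσ : 1 ≤ σ) :
    -- the integral defining the constant converges
    IntegrableOn (Jigsaw.poissonRate σ) (Set.Ioi 0) volume ∧
    -- the critical probability is well defined
    (∀ n : ℕ, 2 ≤ n →
      ∃! p : unitInterval, Jigsaw.IsCriticalProb (Jigsaw.ringSolveProb σ n) p) ∧
    -- its asymptotics, and the sharp transition
    ∀ pc : ℕ → unitInterval,
      (∀ n : ℕ, 2 ≤ n → Jigsaw.IsCriticalProb (Jigsaw.ringSolveProb σ n) (pc n)) →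
        Tendsto (fun n : ℕ => (pc n : ℝ) * Real.log (n : ℝ)) atTop (𝓝 (Jigsaw.ringConst σ)) ∧
        Jigsaw.SharpTransition (Jigsaw.ringSolveProb σ) pc :=
  ⟨Jigsaw.integrableOn_poissonRate hσ, fun _ hn => Jigsaw.existsUnique_isCriticalProb hσ hn,
    fun _ hpc => ⟨Jigsaw.tendsto_criticalProb_mul_log hσ hpc,
      Jigsaw.sharpTransition_ringSolveProb hσ hpc⟩⟩
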